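/- Let $n\ge 1$. For a convex body $K\subset\mathbb{R}^n$ (a compact convex set with nonempty interior) containing the origin $o$ in its interior, let $h_K(u)=\max_{x\in K}\langle x,u\rangle$ and $\rho_K(u)=\max\{\lambda\ge 0:\lambda u\in K\}$, $u\in S^{n-1}$, be its support and radial functions, and let $K^\circ=\{x:\langle x,y\rangle\le 1\ \text{for all}\ y\in K\}$ be its polar body. Let $B^n$ be the closed unit ball and let $du$ be the spherical Lebesgue measure on $S^{n-1}$. Let $G:(0,\infty)\times S^{n-1}\to(0,\infty)$ be continuous and such that, for every $u\in S^{n-1}$, the function $t\mapsto G(t,u)$ is strictly increasing and convex on $(0,\infty)$, with $\lim_{t\to 0^+}G(t,u)=0$ and $\lim_{t\to\infty}G(t,u)=\infty$. Assume that there is a real $q\ge n-1$ with $$\inf\big\{t^{-q}G(t,u):\ t\ge 1,\ u\in S^{n-1}\big\}>0 .$$ Put $$\widetilde V_G(K)=\int_{S^{n-1}}G(\rho_K(u),u)\,du,\qquad \widehat V_G(K)=\inf\Big\{\eta>0:\int_{S^{n-1}}G\Big(\frac{\rho_K(u)}{\eta},u\Big)du\le 1\Big\},$$ and let $\widetilde{\mathcal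 B}$ (respectively $\widehat{\mathcal B}$) be the set of convex bodies $Q$ with $o\in\mathrm{int}\,Q$ and $\widetilde V_G(Q^\circ)=\widetilde V_G(B^n)$ (respectively $\widehat V_G(Q^\circ)=\widehat V_G(B^n)$). Let $\varphi:(0,\infty)\to(0,\infty)$ be continuous, strictly increasing and convex with $\lim_{t\to0^+}\varphi(t)=0$, $\varphi(1)=1$ and $\lim_{t\to\infty}\varphi(t)=\infty$. Let $\mu$ and $\mu_i$ $(i\in\mathbb{N})$ be nonzero finite Borel measures on $S^{n-1}$, none of them concentrated on a closed hemisphere, such that $\mu_i\to\mu$ weakly. Then: i) for each measure $\nu\in\{\mu\}\cup\{\mu_i:i\in\mathbb{N}\}$ the problem $\inf\big\{\int_{S^{n-1}}\varphi(h_Q(u))\,d\nu(u): Q\in\widetilde{\mathcal B}\big\}$ has a unique minimizer in $\widetilde{\mathcal B}$; and, if $\widetilde M_i$ and $\widetilde M$ denote the minimizers for $\mu_i$ and $\mu$, then $\widetilde M_i\to\widetilde M$ in the Hausdorff metric as $i\to\infty$; ii) the same holds with $\widehat{\mathcal B}$ in place of $\widetilde{\mathcal B}$: for each such $\nu$ there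 is a unique minimizer in $\widehat{\mathcal B}$, and the minimizers $\widehat M_i$ for $\mu_i$ converge in the Hausdorff metric to the minimizer $\widehat M$ for $\mu$. -/

import Mathlib

open MeasureTheory Set Filter Topology

namespace DualPolar

noncomputable section

/-- Euclidean `n`-space. -/
abbrev Space (n : ℕ) : Type := EuclideanSpace ℝ (Fin n)

/-- The unit sphere of Euclidean `n`-space. -/
abbrev USphere (n : ℕ) : Type := Metric.sphere (0 : Space n) 1

/-- The spherical Lebesgue measure `du`, of total mass `n` times the volume of the unit ball
(the `(n-1)`-dimensional Hausdorff measure in its usual normalization). -/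
def sphericalMeasure (n : ℕ) : Measure (USphere n) :=
  (volume : Measure (Space n)).toSphere

/-- The support function `h_K(u) = max {⟪x, u⟫ : x ∈ K}`. -/
def supportFn {n : ℕ} (K : Set (Space n)) (u : USphere n) : ℝ :=
  sSup ((fun x : Space n => inner ℝ x (u : Space n)) '' K)

/-- The radial function `ρ_K(u) = max {t ≥ 0 : t u ∈ K}`. -/
def radialFn {n : ℕ} (K : Set (Space n)) (u : USphere n) : ℝ :=
  sSup {t : ℝ | 0 ≤ t ∧ t • (u : Space n) ∈ K}

/-- The polar body `K° = {x : ⟪x, y⟫ ≤ 1 for all y ∈ K}`. -/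
def polarBody {n : ℕ} (K : Set (Space n)) : Set (Space n) :=
  {x | ∀ y ∈ K, inner ℝ x y ≤ 1}

/-- The general dual volume `∫ G(ρ_K(u), u) du`. -/
def dualVolume {n : ℕ} (G : ℝ → USphere n → ℝ) (K : Set (Space n)) : ℝ :=
  ∫ u, G (radialFn K u) u ∂(sphericalMeasure n)

/-- The homogeneous general dual volume
`inf {η > 0 : ∫ G(ρ_K(u) / η, u) du ≤ 1}`, for `G` increasing in its first variable. -/
def homDualVolume {n : ℕ} (G : ℝ → USphere n → ℝ) (K : Set (Space n)) : ℝ :=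
  sInf {η : ℝ | 0 < η ∧ ∫ u, G (radialFn K u / η) u ∂(sphericalMeasure n) ≤ 1}

/-- The class `𝓖_I` of continuous functions `G : (0, ∞) × S^{n-1} → (0, ∞)` that are strictly
increasing in `t`, with limits `0` at `0+` and `∞` at `∞`. Only the values of `G` at `t > 0`
matter. -/
structure ClassGI {n : ℕ} (G : ℝ → USphere n → ℝ) : Prop where
  continuousOn : ContinuousOn (fun p : ℝ × USphere n => G p.1 p.2) (Ioi 0 ×ˢ univ)
  pos : ∀ t, 0 < t → ∀ u, 0 < G t u
  strictMonoOn : ∀ u, StrictMonoOn (fun t => G t u) (Ioi 0)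
  tendsto_zero : ∀ u, Tendsto (fun t => G t u) (𝓝[>] 0) (𝓝 0)
  tendsto_atTop : ∀ u, Tendsto (fun t => G t u) atTop atTop

/-- The growth condition with exponent `q`:
`inf {G(t, u) / t ^ q : t ≥ 1, u ∈ S^{n-1}} > 0`. -/
def GrowthCondition {n : ℕ} (G : ℝ → USphere n → ℝ) (q : ℝ) : Prop :=
  0 < sInf {x : ℝ | ∃ (t : ℝ) (u : USphere n), 1 ≤ t ∧ x = G t u / t ^ q}

/-- The class `𝓘` of continuous strictly increasing `φ : (0, ∞) → (0, ∞)` with `φ(0+) = 0`,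
`φ(1) = 1`, `φ(∞) = ∞`. Only the values of `φ` at `t > 0` matter. -/
structure ClassI (φ : ℝ → ℝ) : Prop where
  continuousOn : ContinuousOn φ (Ioi 0)
  pos : ∀ t, 0 < t → 0 < φ t
  strictMonoOn : StrictMonoOn φ (Ioi 0)
  tendsto_zero : Tendsto φ (𝓝[>] 0) (𝓝 0)
  map_one : φ 1 = 1
  tendsto_atTop : Tendsto φ atTop atTop

/-- The convex bodies `Q` with the origin in their interior such that `Q°` has the same general
dual volume as the unit ball. -/
def tildeB {n : ℕ} (G : ℝ → USphere n → ℝ) : Set (ConvexBody (Space n)) :=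
  {Q | (0 : Space n) ∈ interior (Q : Set (Space n)) ∧
    dualVolume G (polarBody (Q : Set (Space n))) = dualVolume G (Metric.closedBall 0 1)}

/-- The convex bodies `Q` with the origin in their interior such that `Q°` has the same
homogeneous general dual volume as the unit ball. -/
def hatB {n : ℕ} (G : ℝ → USphere n → ℝ) : Set (ConvexBody (Space n)) :=
  {Q | (0 : Space n) ∈ interior (Q : Set (Space n)) ∧
    homDualVolume G (polarBody (Q : Set (Space n))) = homDualVolume G (Metric.closedBall 0 1)}

/-- The objective `∫ φ(h_Q(u)) dμ(u)`. -/
def orliczIntegral {n : ℕ} (φ : ℝ → ℝ) (μ : FiniteMeasure (USphere n))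
    (Q : ConvexBody (Space n)) : ℝ :=
  ∫ u, φ (supportFn (Q : Set (Space n)) u) ∂(μ : Measure (USphere n))

/-- `M` solves the problem of minimizing `∫ φ(h_Q) dμ` over `Q ∈ B`. -/
def IsSolution {n : ℕ} (φ : ℝ → ℝ) (μ : FiniteMeasure (USphere n))
    (B : Set (ConvexBody (Space n))) (M : ConvexBody (Space n)) : Prop :=
  M ∈ B ∧ orliczIntegral φ μ M = sInf (orliczIntegral φ μ '' B)

/-- `μ` is not concentrated on any closed hemisphere `{u : ⟪u, v⟫ ≥ 0}`. -/
def NotConcentratedOnHemisphere {n : ℕ} (μ : FiniteMeasure (USphere n)) : Prop :=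
  ∀ v : USphere n,
    (μ : Measure (USphere n)) {u : USphere n | 0 ≤ inner ℝ (u : Space n) (v : Space n)}ᶜ ≠ 0

end

end DualPolar

namespace DualPolar

noncomputable section

open scoped Pointwise

variable {n : ℕ}

/-! ### Support functions -/

/-! Since `ρ_{Q°} = 1 / h_Q`, the first constraint reads `∫ G(1/h_Q, u) du = ∫ G(1, u) du`, and the
whole problem can be phrased in terms of support functions.

Existence is the direct method. The unit ball is admissible with objective `μ.mass`, so only bodies
with objective at most `μ.mass` matter. For them `φ(t) ≥ t - 1`, together with a positive lower
bound for `∫ max ⟪u, v⟫ 0 dμ(u)` over `v`, gives an outer radius `R`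
(`exists_norm_le_of_orliczIntegral_le`). An inner radius `r` comes from the constraint: `h_Q` is
`R`-Lipschitz, so if `h_Q(v)` were tiny, `G(1/h_Q, u)` would be at least of order `|u - v|^(-p)`
near `v` with `p ≥ n - 1`, whose integral over the sphere diverges
(`exists_le_supportFn_of_integral_le`). Between these radii the admissible class is compact by
Blaschke selection, and the objective is continuous.

Uniqueness comes from the Minkowski midpoint of two minimizers. Convexity of `φ` keeps its objective
at most the minimum, while convexity of `G` and strict convexity of `1/t` put its dual volume
strictly below the prescribed value; it can therefore be shrunk to an admissible body with smaller
objective (`exists_smul_mem_tildeB`, `integral_midpoint_lt`).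

The radii can be chosen uniformly for measures near the limit, so the minimizers eventually lie in
one compact set. By joint continuity each cluster point minimizes the limit problem, hence equals
the unique minimizer.

For the homogeneous volume, let `a` be its value at the ball. Both constraints then amount to an
equation at scale `a`, so `hatB G` is `tildeB` of `G(·/a)`, which satisfies the same hypotheses
(`ClassGI.hatB_eq_tildeB_rescale`). -/

lemma inner_le_supportFn (K : ConvexBody (Space n)) (u : USphere n) {x : Space n} (hx : x ∈ K) :
    inner ℝ x (u : Space n) ≤ supportFn (K : Set (Space n)) u :=
  le_csSup (K.isCompact.image (by fun_prop)).bddAbove (mem_image_of_mem _ hx)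

lemma supportFn_le (K : ConvexBody (Space n)) (u : USphere n) {c : ℝ}
    (h : ∀ x ∈ K, inner ℝ x (u : Space n) ≤ c) : supportFn (K : Set (Space n)) u ≤ c :=
  csSup_le (K.nonempty.image _) (by rintro _ ⟨x, hx, rfl⟩; exact h x hx)

lemma exists_inner_eq_supportFn (K : ConvexBody (Space n)) (u : USphere n) :
    ∃ x ∈ K, inner ℝ x (u : Space n) = supportFn (K : Set (Space n)) u := by
  obtain ⟨x, hx, h⟩ := (K.isCompact.image
    (f := fun x : Space n => inner ℝ x (u : Space n)) (by fun_prop)).sSup_mem (K.nonempty.image _)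
  exact ⟨x, hx, h⟩

lemma supportFn_add (K L : ConvexBody (Space n)) (u : USphere n) :
    supportFn ((K + L : ConvexBody (Space n)) : Set (Space n)) u =
      supportFn (K : Set (Space n)) u + supportFn (L : Set (Space n)) u := by
  apply le_antisymm
  · refine supportFn_le _ _ fun x hx => ?_
    obtain ⟨y, hy, z, hz, rfl⟩ : x ∈ (K : Set (Space n)) + (L : Set (Space n)) := hx
    rw [inner_add_left]
    exact add_le_add (inner_le_supportFn K u hy) (inner_le_supportFn L u hz)
  · obtain ⟨y, hy, hy'⟩ := exists_inner_eq_supportFn K u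
    obtain ⟨z, hz, hz'⟩ := exists_inner_eq_supportFn L u
    rw [← hy', ← hz', ← inner_add_left]
    exact inner_le_supportFn (K + L) u (Set.add_mem_add hy hz)

lemma supportFn_smul (K : ConvexBody (Space n)) (u : USphere n) {c : ℝ} (hc : 0 ≤ c) :
    supportFn ((c • K : ConvexBody (Space n)) : Set (Space n)) u =
      c * supportFn (K : Set (Space n)) u := by
  apply le_antisymm
  · refine supportFn_le _ _ fun x hx => ?_
    obtain ⟨y, hy, rfl⟩ : x ∈ c • (K : Set (Space n)) := hx
    simp only [real_inner_smul_left]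
    exact mul_le_mul_of_nonneg_left (inner_le_supportFn K u hy) hc
  · obtain ⟨y, hy, hy'⟩ := exists_inner_eq_supportFn K u
    rw [← hy', ← real_inner_smul_left]
    exact inner_le_supportFn (c • K) u (smul_mem_smul_set hy)

lemma supportFn_le_add_dist (K L : ConvexBody (Space n)) (u : USphere n) :
    supportFn (K : Set (Space n)) u ≤ supportFn (L : Set (Space n)) u + dist K L := by
  obtain ⟨x, hx, hx'⟩ := exists_inner_eq_supportFn K u
  obtain ⟨y, hy, hxy⟩ := L.isCompact.exists_infDist_eq_dist L.nonempty x
  have h1 : dist x y ≤ dist K L := by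
    rw [← hxy]
    exact Metric.infDist_le_hausdorffDist_of_mem hx ConvexBody.hausdorffEDist_ne_top
  have h2 : inner ℝ (x - y) (u : Space n) ≤ ‖x - y‖ * ‖(u : Space n)‖ := real_inner_le_norm _ _
  rw [inner_sub_left, norm_eq_of_mem_sphere u, mul_one, ← dist_eq_norm] at h2
  linarith [inner_le_supportFn L u hy]

lemma supportFn_le_add_norm (K : ConvexBody (Space n)) {R : ℝ} (hR : ∀ x ∈ K, ‖x‖ ≤ R)
    (u v : USphere n) :
    supportFn (K : Set (Space n)) u ≤ supportFn (K : Set (Space n)) v + R * dist u v := by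
  obtain ⟨x, hx, hx'⟩ := exists_inner_eq_supportFn K u
  have h2 : inner ℝ x ((u : Space n) - v) ≤ ‖x‖ * ‖(u : Space n) - v‖ := real_inner_le_norm _ _
  have h3 : ‖x‖ * ‖(u : Space n) - v‖ ≤ R * dist u v := by
    rw [Subtype.dist_eq, dist_eq_norm]
    exact mul_le_mul_of_nonneg_right (hR x hx) (norm_nonneg _)
  rw [inner_sub_right] at h2
  linarith [inner_le_supportFn K v hx]

/-- Joint continuity follows from two Lipschitz bounds: constant `1` in the body for the Hausdorff
distance, and constant `R` in the direction for the one fixed body `L`. -/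
lemma continuous_supportFn :
    Continuous fun p : ConvexBody (Space n) × USphere n =>
      supportFn (p.1 : Set (Space n)) p.2 := by
  rw [continuous_iff_continuousAt]
  rintro ⟨L, v⟩
  obtain ⟨R, hR⟩ := L.isBounded.exists_norm_le
  have hlim : Tendsto (fun p : ConvexBody (Space n) × USphere n =>
      dist p.1 L + R * dist p.2 v) (𝓝 (L, v)) (𝓝 0) := by
    have : Continuous (fun p : ConvexBody (Space n) × USphere n =>
      dist p.1 L + R * dist p.2 v) := by fun_prop
    simpa using this.tendsto (L, v)
  refine tendsto_iff_dist_tendsto_zero.2 (squeeze_zero (fun _ => dist_nonneg) ?_ hlim)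
  rintro ⟨K, u⟩
  rw [Real.dist_eq, abs_le]
  have h1 := supportFn_le_add_dist K L u
  have h2 := supportFn_le_add_dist L K u
  have h3 := supportFn_le_add_norm L hR u v
  have h4 := supportFn_le_add_norm L hR v u
  rw [dist_comm L K] at h2
  rw [dist_comm v u] at h4
  constructor <;> linarith

lemma continuous_supportFn_right (K : ConvexBody (Space n)) :
    Continuous fun u : USphere n => supportFn (K : Set (Space n)) u :=
  continuous_supportFn.comp (by fun_prop : Continuous fun u : USphere n => (K, u))

/-- A point outside is strictly separated from the body by Hahn–Banach; normalizing the Riesz vector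
of the separating functional yields a violated direction. -/
lemma mem_of_forall_inner_le_supportFn (K : ConvexBody (Space n)) {x : Space n}
    (h : ∀ u : USphere n, inner ℝ x (u : Space n) ≤ supportFn (K : Set (Space n)) u) : x ∈ K := by
  by_contra hx
  obtain ⟨f, c, hf, hc⟩ := geometric_hahn_banach_closed_point K.convex K.isClosed hx
  obtain ⟨w, rfl⟩ := (InnerProductSpace.toDual ℝ (Space n)).surjective f
  simp only [InnerProductSpace.toDual_apply_apply] at hf hc
  have hw : w ≠ 0 := by
    rintro rfl
    obtain ⟨y, hy⟩ := K.nonempty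
    have := hf y hy
    simp only [inner_zero_left] at this hc
    linarith
  have hw' : 0 < ‖w‖ := norm_pos_iff.2 hw
  let u : USphere n := ⟨‖w‖⁻¹ • w, by simp [norm_smul, hw'.ne']⟩
  obtain ⟨y, hy, hyu⟩ := exists_inner_eq_supportFn K u
  have h1 := h u
  rw [← hyu] at h1
  simp only [u, real_inner_smul_right] at h1
  have h2 := le_of_mul_le_mul_left h1 (inv_pos.2 hw')
  rw [real_inner_comm w x, real_inner_comm w y] at h2
  linarith [hf y hy]

lemma eq_of_supportFn_eq {K L : ConvexBody (Space n)}
    (h : ∀ u, supportFn (K : Set (Space n)) u = supportFn (L : Set (Space n)) u) : K = L := by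
  ext x
  exact ⟨fun hx => mem_of_forall_inner_le_supportFn L fun u => h u ▸ inner_le_supportFn K u hx,
    fun hx => mem_of_forall_inner_le_supportFn K fun u => h u ▸ inner_le_supportFn L u hx⟩

lemma closedBall_subset_of_le_supportFn (K : ConvexBody (Space n)) {r : ℝ}
    (h : ∀ u, r ≤ supportFn (K : Set (Space n)) u) :
    Metric.closedBall 0 r ⊆ (K : Set (Space n)) := by
  intro x hx
  refine mem_of_forall_inner_le_supportFn K fun u => (real_inner_le_norm _ _).trans ?_
  rw [norm_eq_of_mem_sphere u, mul_one]
  exact (mem_closedBall_zero_iff.1 hx).trans (h u)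

lemma supportFn_pos (K : ConvexBody (Space n)) (h : (0 : Space n) ∈ interior (K : Set (Space n)))
    (u : USphere n) : 0 < supportFn (K : Set (Space n)) u := by
  obtain ⟨r, hr, hrK⟩ := Metric.mem_nhds_iff.1 (mem_interior_iff_mem_nhds.1 h)
  have hmem : (r / 2) • (u : Space n) ∈ K := hrK <| by
    rw [mem_ball_zero_iff, norm_smul, norm_eq_of_mem_sphere u, Real.norm_of_nonneg (by linarith)]
    linarith
  have := inner_le_supportFn K u hmem
  rw [real_inner_smul_left, real_inner_self_eq_norm_sq, norm_eq_of_mem_sphere u] at this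
  linarith

lemma zero_mem_interior_of_le_supportFn (K : ConvexBody (Space n)) {r : ℝ} (hr : 0 < r)
    (h : ∀ u, r ≤ supportFn (K : Set (Space n)) u) :
    (0 : Space n) ∈ interior (K : Set (Space n)) :=
  mem_interior_iff_mem_nhds.2 <| mem_of_superset (Metric.closedBall_mem_nhds 0 hr)
    (closedBall_subset_of_le_supportFn K h)

lemma exists_le_supportFn (K : ConvexBody (Space n))
    (h : ∀ u, 0 < supportFn (K : Set (Space n)) u) :
    ∃ r > 0, ∀ u, r ≤ supportFn (K : Set (Space n)) u := by
  rcases isEmpty_or_nonempty (USphere n) with _ | _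
  · exact ⟨1, one_pos, isEmptyElim⟩
  · obtain ⟨u, -, hu⟩ := isCompact_univ.exists_isMinOn univ_nonempty
      (continuous_supportFn_right K).continuousOn
    exact ⟨_, h u, fun v => hu (mem_univ v)⟩

lemma zero_mem_interior_iff (K : ConvexBody (Space n)) :
    (0 : Space n) ∈ interior (K : Set (Space n)) ↔ ∀ u, 0 < supportFn (K : Set (Space n)) u := by
  refine ⟨supportFn_pos K, fun h => ?_⟩
  obtain ⟨r, hr, hrK⟩ := exists_le_supportFn K h
  exact zero_mem_interior_of_le_supportFn K hr hrK

/-- The ray in direction `u` meets the polar in the segment of parameters `[0, 1/h_K(u)]`. This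
turns both dual volumes of polars into integrals of support functions. -/
lemma radialFn_polarBody (K : ConvexBody (Space n)) (u : USphere n)
    (h : 0 < supportFn (K : Set (Space n)) u) :
    radialFn (polarBody (K : Set (Space n))) u = (supportFn (K : Set (Space n)) u)⁻¹ := by
  have : {t : ℝ | 0 ≤ t ∧ t • (u : Space n) ∈ polarBody (K : Set (Space n))} =
      Icc 0 (supportFn (K : Set (Space n)) u)⁻¹ := by
    ext t
    simp only [polarBody, mem_ofPred_eq, mem_Icc, real_inner_smul_left]
    refine and_congr_right fun ht => ⟨fun H => ?_, fun H y hy => ?_⟩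
    · obtain ⟨y, hy, hyu⟩ := exists_inner_eq_supportFn K u
      have := H y hy
      rw [real_inner_comm, hyu] at this
      rwa [← one_div, le_div_iff₀ h]
    · rw [← one_div, le_div_iff₀ h] at H
      rw [real_inner_comm]
      exact (mul_le_mul_of_nonneg_left (inner_le_supportFn K u hy) ht).trans H
  rw [radialFn, this, csSup_Icc (inv_nonneg.2 h.le)]

lemma radialFn_closedBall (u : USphere n) :
    radialFn (Metric.closedBall (0 : Space n) 1) u = 1 := by
  have : {t : ℝ | 0 ≤ t ∧ t • (u : Space n) ∈ Metric.closedBall (0 : Space n) 1} = Icc 0 1 := by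
    ext t
    simp only [mem_ofPred_eq, mem_Icc, mem_closedBall_zero_iff, norm_smul,
      norm_eq_of_mem_sphere u, mul_one]
    exact and_congr_right fun ht => by rw [Real.norm_of_nonneg ht]
  rw [radialFn, this, csSup_Icc zero_le_one]

/-- The closed unit ball as a convex body. -/
def unitBall (n : ℕ) : ConvexBody (Space n) :=
  ⟨Metric.closedBall 0 1, convex_closedBall 0 1, isCompact_closedBall 0 1, ⟨0, by simp⟩⟩

lemma supportFn_unitBall (u : USphere n) :
    supportFn (unitBall n : Set (Space n)) u = 1 := by
  apply le_antisymm
  · refine supportFn_le _ _ fun x hx => (real_inner_le_norm _ _).trans ?_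
    rw [norm_eq_of_mem_sphere u, mul_one]
    exact mem_closedBall_zero_iff.1 hx
  · have : (u : Space n) ∈ unitBall n :=
      mem_closedBall_zero_iff.2 (norm_eq_of_mem_sphere u).le
    simpa [real_inner_self_eq_norm_sq] using inner_le_supportFn _ u this

/-! ### Blaschke selection -/

lemma isCompact_closure_convexHull {s : Set (Space n)} (hs : IsCompact s) :
    IsCompact (closure (convexHull ℝ s)) :=
  (isBounded_convexHull.2 hs.isBounded).isCompact_closure

/-- A closed thickening of a convex set is convex, so as soon as it contains `s` it contains the
hull of `s`. Taking closed convex hulls is therefore 1-Lipschitz. -/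
lemma exists_dist_le_hausdorffDist_of_mem_closure_convexHull {s t : Set (Space n)}
    (hs : IsCompact s) (ht : IsCompact t) (hs' : s.Nonempty) (ht' : t.Nonempty)
    {x : Space n} (hx : x ∈ closure (convexHull ℝ s)) :
    ∃ y ∈ closure (convexHull ℝ t), dist x y ≤ Metric.hausdorffDist s t := by
  have hsub : closure (convexHull ℝ s) ⊆
      Metric.cthickening (Metric.hausdorffDist s t) (closure (convexHull ℝ t)) := by
    rw [Metric.cthickening_closure]
    refine closure_minimal (convexHull_min (fun y hy => ?_)
      ((convex_convexHull ℝ t).cthickening _)) Metric.isClosed_cthickening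
    refine Metric.cthickening_subset_of_subset _ (subset_convexHull ℝ t) ?_
    obtain ⟨z, hz, hyz⟩ := ht.exists_infDist_eq_dist ht' y
    refine Metric.mem_cthickening_of_dist_le y z _ t hz ?_
    rw [← hyz]
    exact Metric.infDist_le_hausdorffDist_of_mem hy
      (Metric.hausdorffEDist_ne_top_of_nonempty_of_bounded hs' ht' hs.isBounded ht.isBounded)
  have hx' := hsub hx
  rw [(isCompact_closure_convexHull ht).cthickening_eq_biUnion_closedBall
    Metric.hausdorffDist_nonneg] at hx'
  simpa only [mem_iUnion, Metric.mem_closedBall, exists_prop] using hx'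

/-- The nonempty compact subsets of a ball form a compact hyperspace; the closed convex hull maps it
continuously onto the convex bodies in that ball, fixing each of them. -/
lemma isCompact_setOf_subset_closedBall (R : ℝ) :
    IsCompact {K : ConvexBody (Space n) | ∀ x ∈ K, ‖x‖ ≤ R} := by
  let F : TopologicalSpace.NonemptyCompacts (Space n) → ConvexBody (Space n) := fun s =>
    ⟨closure (convexHull ℝ s), (convex_convexHull ℝ _).closure,
      isCompact_closure_convexHull s.isCompact, s.nonempty.convexHull.closure⟩
  have hF : Continuous F := by
    refine (LipschitzWith.mk_one fun s t => ?_).continuous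
    rw [Metric.NonemptyCompacts.dist_eq]
    refine Metric.hausdorffDist_le_of_mem_dist Metric.hausdorffDist_nonneg
      (fun x hx => exists_dist_le_hausdorffDist_of_mem_closure_convexHull
        s.isCompact t.isCompact s.nonempty t.nonempty hx) fun x hx => ?_
    rw [Metric.hausdorffDist_comm]
    exact exists_dist_le_hausdorffDist_of_mem_closure_convexHull
      t.isCompact s.isCompact t.nonempty s.nonempty hx
  have hc : IsCompact {s : TopologicalSpace.NonemptyCompacts (Space n) |
      (s : Set (Space n)) ⊆ Metric.closedBall 0 R} :=
    TopologicalSpace.NonemptyCompacts.isCompact_subsets_of_isCompact (isCompact_closedBall 0 R)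
  convert hc.image hF using 1
  ext K
  constructor
  · intro hK
    refine ⟨⟨⟨K, K.isCompact⟩, K.nonempty⟩, fun x hx => ?_, ?_⟩
    · exact mem_closedBall_zero_iff.2 (hK x hx)
    · refine ConvexBody.ext ?_
      change closure (convexHull ℝ (K : Set (Space n))) = K
      rw [K.convex.convexHull_eq, K.isClosed.closure_eq]
  · rintro ⟨s, hs, rfl⟩ x hx
    exact mem_closedBall_zero_iff.1 (closure_minimal
      (convexHull_min hs (convex_closedBall 0 R)) Metric.isClosed_closedBall hx)

/-! ### Spherical caps -/

instance : IsFiniteMeasure (sphericalMeasure n) :=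
  inferInstanceAs (IsFiniteMeasure (volume : Measure (Space n)).toSphere)

instance : (sphericalMeasure n).IsOpenPosMeasure :=
  inferInstanceAs ((volume : Measure (Space n)).toSphere.IsOpenPosMeasure)

/-- The spherical measure of a cap is `n` times the volume of the sector over it, so caps are
bounded below by packing balls into sectors. A point `y` of the ball has norm at least `3/16`, and
its direction is within `(2s/16)/(3/16) < s` of `v`. -/
lemma ball_smul_subset_sector (v : USphere n) {s t : ℝ} (hs : 0 < s) (hs1 : s ≤ 1)
    (ht : 1 / 4 ≤ t) (ht' : t ≤ 1 / 2) :
    Metric.ball (t • (v : Space n)) (s / 16) ⊆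
      Ioo (0 : ℝ) 1 • ((↑) '' Metric.ball v s : Set (Space n)) := by
  intro y hy
  rw [mem_ball_iff_norm] at hy
  have hv : ‖(v : Space n)‖ = 1 := norm_eq_of_mem_sphere v
  have htv : ‖t • (v : Space n)‖ = t := by
    rw [norm_smul, hv, mul_one, Real.norm_of_nonneg (by linarith)]
  have habs := abs_le.1 (abs_norm_sub_norm_le y (t • (v : Space n)))
  rw [htv] at habs
  have hy0 : 3 / 16 ≤ ‖y‖ := by linarith
  have hypos : 0 < ‖y‖ := by linarith
  let u : USphere n := ⟨‖y‖⁻¹ • y, by simp [norm_smul, hypos.ne']⟩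
  refine ⟨‖y‖, ⟨hypos, by linarith⟩, u, ⟨u, ?_, rfl⟩, by simp [u, hypos.ne']⟩
  rw [Metric.mem_ball, Subtype.dist_eq, dist_eq_norm]
  have h1 : ‖y‖ * ‖(u : Space n) - v‖ = ‖(y - t • (v : Space n)) + (t - ‖y‖) • (v : Space n)‖ := by
    conv_lhs => rw [← Real.norm_of_nonneg hypos.le, norm_norm, ← norm_norm y, ← norm_smul]
    congr 1
    simp only [u, smul_sub, sub_smul, smul_smul, mul_inv_cancel₀ hypos.ne', one_smul]
    abel
  have h2 := norm_add_le (y - t • (v : Space n)) ((t - ‖y‖) • (v : Space n))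
  rw [← h1, norm_smul, hv, mul_one, Real.norm_eq_abs] at h2
  have h3 : |t - ‖y‖| ≤ ‖y - t • (v : Space n)‖ := abs_le.2 ⟨by linarith, by linarith⟩
  have h4 : 3 / 16 * ‖(u : Space n) - v‖ ≤ ‖y‖ * ‖(u : Space n) - v‖ :=
    mul_le_mul_of_nonneg_right hy0 (norm_nonneg _)
  linarith

lemma natCast_mul_le_sphericalMeasure_ball (v : USphere n) {N : ℕ} (hN : 0 < N) :
    (n : ℝ) * (N * ((1 / (16 * N)) ^ n * (volume : Measure (Space n)).real (Metric.ball 0 1))) ≤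
      (sphericalMeasure n).real (Metric.ball v (1 / N)) := by
  have hN' : (0 : ℝ) < N := Nat.cast_pos.2 hN
  have hv : ‖(v : Space n)‖ = 1 := norm_eq_of_mem_sphere v
  -- `N` balls of radius `1/(16N)` with centres spaced `1/(4N)` along the ray: they are disjoint and
  -- have total volume of order `N^(1-n)`, the correct order for the cap.
  let t : ℕ → ℝ := fun k => 1 / 4 + k / (4 * N)
  let B : ℕ → Set (Space n) := fun k => Metric.ball (t k • (v : Space n)) (1 / N / 16)
  have hr : (0 : ℝ) < 1 / N / 16 := by positivity
  have hBsub : (⋃ k ∈ Finset.range N, B k) ⊆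
      Ioo (0 : ℝ) 1 • ((↑) '' Metric.ball v (1 / N) : Set (Space n)) := by
    refine iUnion₂_subset fun k hk => ball_smul_subset_sector v (by positivity) ?_ ?_ ?_
    · rw [div_le_one hN']
      exact_mod_cast hN
    · have : (0 : ℝ) ≤ k / (4 * N) := by positivity
      simp only [t]
      linarith
    · have hk' : (k : ℝ) ≤ N := by exact_mod_cast (Finset.mem_range.1 hk).le
      have : (k : ℝ) / (4 * N) ≤ 1 / 4 := by
        rw [div_le_div_iff₀ (by positivity) (by norm_num)]
        linarith
      simp only [t]
      linarith
  have hdisj : PairwiseDisjoint (↑(Finset.range N)) B := by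
    intro k _ l _ hkl
    refine Metric.ball_disjoint_ball ?_
    rw [dist_eq_norm, ← sub_smul, norm_smul, hv, mul_one, Real.norm_eq_abs]
    have h1 : t k - t l = (1 / (4 * N)) * ((k : ℝ) - l) := by
      simp only [t]
      ring
    have h2 : (1 : ℝ) ≤ |(k : ℝ) - l| := by
      have : (1 : ℤ) ≤ |(k : ℤ) - l| := Int.one_le_abs (by omega)
      exact_mod_cast this
    rw [h1, abs_mul, abs_of_pos (by positivity : (0 : ℝ) < 1 / (4 * N))]
    calc (1 : ℝ) / N / 16 + 1 / N / 16 ≤ 1 / (4 * N) * 1 := by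
          have : (1 : ℝ) / N / 16 + 1 / N / 16 = 1 / N / 8 := by ring
          rw [this, mul_one, div_div]
          exact one_div_le_one_div_of_le (by positivity) (by linarith)
      _ ≤ _ := mul_le_mul_of_nonneg_left h2 (by positivity)
  have hsum : (volume : Measure (Space n)).real (⋃ k ∈ Finset.range N, B k) =
      N * ((1 / (16 * N)) ^ n * (volume : Measure (Space n)).real (Metric.ball 0 1)) := by
    rw [measureReal_biUnion_finset hdisj fun _ _ => measurableSet_ball]
    have : ∀ k ∈ Finset.range N, (volume : Measure (Space n)).real (B k) =
        (1 / (16 * N)) ^ n * (volume : Measure (Space n)).real (Metric.ball 0 1) := by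
      intro k _
      simp only [B]
      rw [measureReal_def, Measure.addHaar_ball_of_pos _ _ hr, finrank_euclideanSpace_fin,
        ENNReal.toReal_mul, ENNReal.toReal_ofReal (by positivity), div_div, mul_comm (N : ℝ) 16,
        measureReal_def]
    rw [Finset.sum_congr rfl this, Finset.sum_const, Finset.card_range, nsmul_eq_mul]
  have hsector : (volume : Measure (Space n))
      (Ioo (0 : ℝ) 1 • ((↑) '' Metric.ball v (1 / N) : Set (Space n))) ≠ ⊤ := by
    refine ((measure_mono ?_).trans_lt
      (measure_ball_lt_top (μ := (volume : Measure (Space n))) (x := 0) (r := 1))).ne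
    rintro _ ⟨a, ha, _, ⟨u, -, rfl⟩, rfl⟩
    simpa [norm_smul, abs_of_pos ha.1] using ha.2
  rw [sphericalMeasure, measureReal_def (Measure.toSphere _),
    Measure.toSphere_apply' _ measurableSet_ball, finrank_euclideanSpace_fin,
    ENNReal.toReal_mul, ENNReal.toReal_natCast, ← hsum]
  exact mul_le_mul_of_nonneg_left (ENNReal.toReal_mono hsector (measure_mono hBsub))
    (Nat.cast_nonneg _)

lemma exists_le_sphericalMeasure_ball (n : ℕ) :
    ∃ c > 0, ∀ (v : USphere n) (N : ℕ), 0 < N →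
      c ≤ (N : ℝ) ^ (n - 1) * (sphericalMeasure n).real (Metric.ball v (1 / N)) := by
  rcases n with _ | m
  -- For `n = 0` the sphere is empty, which also disposes of the truncated exponent `n - 1`.
  · refine ⟨1, one_pos, fun v => ?_⟩
    have := norm_eq_of_mem_sphere v
    rw [Subsingleton.elim (v : Space 0) 0, norm_zero] at this
    exact absurd this zero_ne_one
  · have hω : 0 < (volume : Measure (Space (m + 1))).real (Metric.ball 0 1) :=
      ENNReal.toReal_pos (Metric.measure_ball_pos _ _ one_pos).ne' measure_ball_lt_top.ne
    refine ⟨(m + 1 : ℕ) * ((1 / 16) ^ (m + 1) *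
      (volume : Measure (Space (m + 1))).real (Metric.ball 0 1)), by positivity,
      fun v N hN => ?_⟩
    have hN' : (0 : ℝ) < N := Nat.cast_pos.2 hN
    refine le_trans (le_of_eq ?_) (mul_le_mul_of_nonneg_left
      (natCast_mul_le_sphericalMeasure_ball v hN) (by positivity))
    have : ((N : ℝ) ^ m) * (N * (1 / (16 * N)) ^ (m + 1)) = (1 / 16) ^ (m + 1) := by
      rw [← mul_assoc, ← pow_succ, ← mul_pow]
      congr 1
      field_simp
    rw [Nat.add_sub_cancel, ← this]
    ring

/-! ### Inner radius estimate -/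

lemma geom_sum_le_two_mul_pow {x : ℝ} (hx : 2 ≤ x) (J : ℕ) :
    ∑ j ∈ Finset.range (J + 1), x ^ j ≤ 2 * x ^ J := by
  induction J with
  | zero => simp
  | succ J ih =>
    rw [Finset.sum_range_succ, pow_succ]
    nlinarith [pow_pos (by linarith : 0 < x) J]

/-- Only the last index `j` with `u ∈ B j` matters: the geometric sum up to it is at most twice its
last term. -/
lemma sum_indicator_le_two_mul {α : Type*} {x A : ℝ} (hx : 2 ≤ x) (hA : 0 ≤ A)
    (B : ℕ → Set α) (u : α) (J : ℕ) (h : ∀ j < J, u ∈ B j → x ^ j ≤ A) :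
    ∑ j ∈ Finset.range J, (B j).indicator (fun _ => x ^ j) u ≤ 2 * A := by
  induction J with
  | zero => simpa using hA
  | succ J ih =>
    by_cases hu : u ∈ B J
    · calc ∑ j ∈ Finset.range (J + 1), (B j).indicator (fun _ => x ^ j) u
          ≤ ∑ j ∈ Finset.range (J + 1), x ^ j :=
            Finset.sum_le_sum fun j _ => indicator_le_self' (fun _ _ => by positivity) u
        _ ≤ 2 * x ^ J := geom_sum_le_two_mul_pow hx J
        _ ≤ 2 * A := by linarith [h J (Nat.lt_succ_self J) hu]
    · rw [Finset.sum_range_succ, indicator_of_notMem hu, add_zero]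
      exact ih fun j hj => h j (hj.trans (Nat.lt_succ_self J))

lemma ClassGI.continuous_comp {G : ℝ → USphere n → ℝ} (hG : ClassGI G) {X : Type*}
    [TopologicalSpace X] {f : X → ℝ} {g : X → USphere n} (hf : Continuous f) (hg : Continuous g)
    (hpos : ∀ x, 0 < f x) : Continuous fun x => G (f x) (g x) :=
  hG.continuousOn.comp_continuous (hf.prodMk hg) fun x => ⟨hpos x, mem_univ _⟩

lemma integrable_of_continuous {μ : Measure (USphere n)} [IsFiniteMeasure μ]
    {f : USphere n → ℝ} (hf : Continuous f) : Integrable f μ :=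
  hf.integrable_of_hasCompactSupport (HasCompactSupport.of_compactSpace f)

/-- `G` grows at least like `t ^ p`, uniformly in the second variable. -/
def HasPowerGrowth (G : ℝ → USphere n → ℝ) (p : ℕ) : Prop :=
  ∃ c > 0, ∃ T > 0, ∀ t ≥ T, ∀ u, c * t ^ p ≤ G t u

/-- Dyadic form of the divergence of `∫ |u - v|^(-p) du` for `p ≥ n - 1`: on the caps of radius
`1/(M 2^j)` around a direction where `h_K` is small, the growth of `G` offsets the decay of the cap
measure, so each scale contributes a fixed amount `κ`. -/
lemma exists_le_supportFn_of_integral_le {G : ℝ → USphere n → ℝ} (hG : ClassGI G) {p : ℕ}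
    (hp : 1 ≤ p) (hnp : n - 1 ≤ p) (hgrowth : HasPowerGrowth G p) {R : ℝ} (hR : 0 < R) (C : ℝ) :
    ∃ r > 0, ∀ K : ConvexBody (Space n), (∀ x ∈ K, ‖x‖ ≤ R) →
      (∀ u, 0 < supportFn (K : Set (Space n)) u) →
      ∫ u, G (supportFn (K : Set (Space n)) u)⁻¹ u ∂(sphericalMeasure n) ≤ C →
      ∀ u, r ≤ supportFn (K : Set (Space n)) u := by
  obtain ⟨c₀, hc₀, T, hT, hGT⟩ := hgrowth
  obtain ⟨c, hc, hcap⟩ := exists_le_sphericalMeasure_ball n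
  -- This makes `1/h ≥ T` already on the largest cap, of radius `1/M`.
  obtain ⟨M, hM⟩ := exists_nat_ge (2 * R * T)
  have hM0 : (0 : ℝ) < M := (by positivity : 0 < 2 * R * T).trans_le hM
  let x : ℝ := 2 ^ p
  have hx : 2 ≤ x := by
    simpa using pow_le_pow_right₀ (by norm_num : (1 : ℝ) ≤ 2) hp
  let c₁ : ℝ := c₀ * (M / (2 * R)) ^ p
  have hc₁ : 0 < c₁ := by positivity
  -- The contribution of one scale; the factor `1/2` pays for the overlap of the caps.
  let κ : ℝ := c₁ * (c / M ^ (n - 1)) / 2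
  have hκ : 0 < κ := by positivity
  obtain ⟨J, hJ⟩ := exists_nat_gt (C / κ)
  rw [div_lt_iff₀ hκ] at hJ
  -- With `h(v)` below this value, the Lipschitz bound gives `h ≤ 2R/(M 2^j)` on each of the `J`
  -- caps, and `J κ > C`.
  refine ⟨R / (M * 2 ^ J), by positivity, fun K hKR hpos hKC v => ?_⟩
  by_contra! hv
  let h : USphere n → ℝ := fun u => supportFn (K : Set (Space n)) u
  let B : ℕ → Set (USphere n) := fun j => Metric.ball v (1 / (M * 2 ^ j : ℕ))
  have hcont : Continuous fun u => G (h u)⁻¹ u :=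
    hG.continuous_comp ((continuous_supportFn_right K).inv₀ fun u => (hpos u).ne') continuous_id
      fun u => inv_pos.2 (hpos u)
  have hpt : ∀ u, c₁ / 2 * ∑ j ∈ Finset.range J, (B j).indicator (fun _ => x ^ j) u ≤
      G (h u)⁻¹ u := by
    intro u
    have hA : 0 < G (h u)⁻¹ u := hG.pos _ (inv_pos.2 (hpos u)) u
    have := sum_indicator_le_two_mul hx (div_pos hA hc₁).le B u J fun j hj hu => ?_
    · rw [mul_div_assoc', le_div_iff₀ hc₁] at this
      linarith
    · have hd : dist u v < 1 / (M * 2 ^ j) := by simpa [B] using hu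
      have h1 : h u ≤ 2 * R / (M * 2 ^ j) := by
        have e1 := supportFn_le_add_norm K hKR u v
        have e2 : R / (M * 2 ^ J) ≤ R / (M * 2 ^ j) := by
          have : (2 : ℝ) ^ j ≤ 2 ^ J := pow_le_pow_right₀ (by norm_num) hj.le
          gcongr
        have e3 : R * dist u v ≤ R * (1 / (M * 2 ^ j)) := by gcongr
        have e4 : R * (1 / (M * 2 ^ j)) = R / (M * 2 ^ j) := by ring
        have e5 : 2 * R / (M * 2 ^ j) = R / (M * 2 ^ j) + R / (M * 2 ^ j) := by ring
        simp only [h]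
        linarith
      have h2 : M * 2 ^ j / (2 * R) ≤ (h u)⁻¹ := by
        rw [← inv_div]
        exact inv_anti₀ (hpos u) h1
      have h3 : T ≤ (h u)⁻¹ := by
        refine le_trans ?_ h2
        rw [le_div_iff₀ (by positivity)]
        have : (1 : ℝ) ≤ 2 ^ j := one_le_pow₀ (by norm_num)
        nlinarith
      rw [le_div_iff₀ hc₁]
      calc x ^ j * c₁ = c₀ * (M * 2 ^ j / (2 * R)) ^ p := by
            simp only [x, c₁]
            rw [← pow_mul, mul_comm p j, pow_mul]
            rw [mul_comm (M : ℝ), mul_div_assoc, mul_pow]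
            ring
        _ ≤ c₀ * ((h u)⁻¹) ^ p := by gcongr
        _ ≤ G (h u)⁻¹ u := hGT _ h3 u
  have hint : ∀ j ∈ Finset.range J,
      Integrable ((B j).indicator fun _ => x ^ j) (sphericalMeasure n) := fun j _ =>
    (integrable_const _).indicator measurableSet_ball
  have hle := integral_mono ((integrable_finsetSum _ hint).const_mul (c₁ / 2))
    (integrable_of_continuous hcont) (by intro u; simpa using hpt u)
  have hlow : J * κ ≤ c₁ / 2 * ∑ j ∈ Finset.range J, (sphericalMeasure n).real (B j) * x ^ j := by
    have : ∀ j ∈ Finset.range J, c / M ^ (n - 1) ≤ (sphericalMeasure n).real (B j) * x ^ j := by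
      intro j _
      have hcapj := hcap v (M * 2 ^ j) (Nat.mul_pos (Nat.cast_pos.1 hM0) (by positivity))
      rw [div_le_iff₀ (by positivity)]
      refine hcapj.trans ?_
      have hxj : ((2 : ℝ) ^ j) ^ (n - 1) ≤ x ^ j := by
        simp only [x]
        rw [← pow_mul, ← pow_mul, mul_comm]
        exact pow_le_pow_right₀ (by norm_num) (Nat.mul_le_mul_right j hnp)
      push_cast
      rw [mul_pow]
      calc (M : ℝ) ^ (n - 1) * (2 ^ j) ^ (n - 1) * _
          ≤ (M : ℝ) ^ (n - 1) * x ^ j * (sphericalMeasure n).real (B j) := by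
            simp only [B]
            push_cast
            gcongr
        _ = _ := by ring
    have h2 := Finset.card_nsmul_le_sum _ _ _ this
    rw [Finset.card_range, nsmul_eq_mul] at h2
    calc J * κ = c₁ / 2 * (J * (c / M ^ (n - 1))) := by
          simp only [κ]
          ring
      _ ≤ _ := by gcongr
  rw [integral_const_mul, integral_finsetSum _ hint] at hle
  simp only [integral_indicator_const _ measurableSet_ball, B, smul_eq_mul] at hle
  simp only [B] at hlow
  linarith

/-! ### Convex functions on the positive half-line -/

/-- Convexity and `f(0+) = 0` make `f(t)/t` nondecreasing; the left endpoint of the chord is reached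
as a limit. -/
lemma mul_le_mul_of_convexOn_Ioi {f : ℝ → ℝ} (hf : ConvexOn ℝ (Ioi 0) f)
    (h0 : Tendsto f (𝓝[>] 0) (𝓝 0)) {s t : ℝ} (hs : 0 < s) (hst : s ≤ t) :
    t * f s ≤ s * f t := by
  rcases hst.eq_or_lt with rfl | hst
  · exact le_rfl
  have hlim : Tendsto (fun δ => (f s - f δ) / (s - δ)) (𝓝[>] 0) (𝓝 ((f s - 0) / (s - 0))) :=
    (tendsto_const_nhds.sub h0).div
      (tendsto_const_nhds.sub (tendsto_id.mono_left nhdsWithin_le_nhds)) (by simpa using hs.ne')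
  have hle : (f s - 0) / (s - 0) ≤ (f t - f s) / (t - s) := by
    refine le_of_tendsto hlim ?_
    filter_upwards [Ioo_mem_nhdsGT hs] with δ hδ
    exact hf.slope_mono_adjacent hδ.1 (hs.trans hst) hδ.2 hst
  rw [sub_zero, sub_zero, div_le_div_iff₀ hs (sub_pos.2 hst)] at hle
  linarith

lemma ClassGI.integral_pos {G : ℝ → USphere n → ℝ} (hG : ClassGI G) [Nonempty (USphere n)]
    {f : USphere n → ℝ} (hf : Continuous f) (hpos : ∀ u, 0 < f u) :
    0 < ∫ u, G (f u) u ∂(sphericalMeasure n) := by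
  have hc : Continuous fun u => G (f u) u := hG.continuous_comp hf continuous_id hpos
  have hp : ∀ u, 0 < G (f u) u := fun u => hG.pos _ (hpos u) u
  rw [integral_pos_iff_support_of_nonneg (fun u => (hp u).le) (integrable_of_continuous hc),
    show Function.support (fun u => G (f u) u) = univ from
      eq_univ_of_forall fun u => (hp u).ne']
  exact isOpen_univ.measure_pos _ univ_nonempty

/-- For `n ≥ 3` the exponent `n - 1` works. For `n ≤ 2` linear growth follows from convexity; this
gives `p ≥ 1` even when `n = 1`, as the dyadic argument needs ratio `2^p ≥ 2`. -/
lemma exists_hasPowerGrowth {G : ℝ → USphere n → ℝ} (hG : ClassGI G)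
    (hconv : ∀ u, ConvexOn ℝ (Ioi 0) (fun t => G t u))
    {q : ℝ} (hq : (n : ℝ) - 1 ≤ q) (hGq : GrowthCondition G q) :
    ∃ p : ℕ, 1 ≤ p ∧ n - 1 ≤ p ∧ HasPowerGrowth G p := by
  rcases le_or_gt n 2 with hn | hn
  · refine ⟨1, le_rfl, by omega, ?_⟩
    rcases isEmpty_or_nonempty (USphere n) with _ | _
    · exact ⟨1, one_pos, 1, one_pos, fun _ _ => isEmptyElim⟩
    obtain ⟨v, -, hv⟩ := isCompact_univ.exists_isMinOn univ_nonempty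
      (hG.continuous_comp continuous_const continuous_id fun _ => one_pos).continuousOn
    refine ⟨G 1 v, hG.pos 1 one_pos v, 1, one_pos, fun t ht u => ?_⟩
    have h1 := mul_le_mul_of_convexOn_Ioi (hconv u) (hG.tendsto_zero u) one_pos ht
    have h2 : G 1 v ≤ G 1 u := hv (mem_univ u)
    have h3 : G 1 v * t ≤ G 1 u * t := mul_le_mul_of_nonneg_right h2 (zero_le_one.trans ht)
    rw [pow_one]
    linarith
  · refine ⟨n - 1, by omega, le_rfl, _, hGq, 1, one_pos, fun t ht u => ?_⟩
    have htpos : 0 < t := one_pos.trans_le ht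
    have h1 : sInf {x : ℝ | ∃ (t : ℝ) (u : USphere n), 1 ≤ t ∧ x = G t u / t ^ q} ≤
        G t u / t ^ q := by
      refine csInf_le ⟨0, ?_⟩ ⟨t, u, ht, rfl⟩
      rintro _ ⟨s, w, hs, rfl⟩
      have hs' : 0 < s := one_pos.trans_le hs
      exact div_nonneg (hG.pos s hs' w).le (Real.rpow_nonneg hs'.le q)
    have h2 : t ^ (n - 1) ≤ t ^ q := by
      rw [← Real.rpow_natCast]
      refine Real.rpow_le_rpow_of_exponent_le ht ?_
      rwa [Nat.cast_sub (by omega), Nat.cast_one]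
    rw [le_div_iff₀ (Real.rpow_pos_of_pos htpos q)] at h1
    exact (mul_le_mul_of_nonneg_left h2 hGq.le).trans h1

lemma ClassI.sub_one_le {φ : ℝ → ℝ} (hφ : ClassI φ) (hconv : ConvexOn ℝ (Ioi 0) φ) {t : ℝ}
    (ht : 0 < t) : t - 1 ≤ φ t := by
  rcases le_total 1 t with h | h
  · have := mul_le_mul_of_convexOn_Ioi hconv hφ.tendsto_zero one_pos h
    rw [hφ.map_one] at this
    linarith
  · linarith [hφ.pos t ht]

/-! ### The admissible class -/

lemma mem_tildeB_iff {G : ℝ → USphere n → ℝ} (K : ConvexBody (Space n)) :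
    K ∈ tildeB G ↔ (∀ u, 0 < supportFn (K : Set (Space n)) u) ∧
      ∫ u, G (supportFn (K : Set (Space n)) u)⁻¹ u ∂(sphericalMeasure n) =
        ∫ u, G 1 u ∂(sphericalMeasure n) := by
  rw [tildeB, mem_ofPred_eq, zero_mem_interior_iff]
  refine and_congr_right fun h => ?_
  simp only [dualVolume, radialFn_closedBall, radialFn_polarBody K _ (h _)]

lemma unitBall_mem_tildeB (G : ℝ → USphere n → ℝ) : unitBall n ∈ tildeB G := by
  rw [mem_tildeB_iff]
  simp [supportFn_unitBall]

lemma orliczIntegral_unitBall {φ : ℝ → ℝ} (hφ : ClassI φ) (μ : FiniteMeasure (USphere n)) :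
    orliczIntegral φ μ (unitBall n) = μ.mass := by
  simp [orliczIntegral, supportFn_unitBall, hφ.map_one, measureReal_def]
  rfl

lemma ClassI.continuous_comp {φ : ℝ → ℝ} (hφ : ClassI φ) {X : Type*} [TopologicalSpace X]
    {f : X → ℝ} (hf : Continuous f) (hpos : ∀ x, 0 < f x) : Continuous fun x => φ (f x) :=
  hφ.continuousOn.comp_continuous hf hpos

lemma isSolution_iff {φ : ℝ → ℝ} (hφ : ClassI φ) {G : ℝ → USphere n → ℝ}
    {μ : FiniteMeasure (USphere n)} {M : ConvexBody (Space n)} :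
    IsSolution φ μ (tildeB G) M ↔
      M ∈ tildeB G ∧ ∀ Q ∈ tildeB G, orliczIntegral φ μ M ≤ orliczIntegral φ μ Q := by
  refine and_congr_right fun hM => ⟨fun h Q hQ => ?_, fun h => ?_⟩
  · rw [h]
    refine csInf_le ⟨0, ?_⟩ (mem_image_of_mem _ hQ)
    rintro _ ⟨K, hK, rfl⟩
    exact integral_nonneg fun u => (hφ.pos _ (((mem_tildeB_iff K).1 hK).1 u)).le
  · refine (IsLeast.csInf_eq ⟨mem_image_of_mem _ hM, ?_⟩).symm
    rintro _ ⟨K, hK, rfl⟩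
    exact h K hK

/-! ### Joint continuity of integrals -/

/-- Write `∫ f dμ = ∫ f₀ dμ + ∫ (f - f₀) dμ`: the first term converges weakly, the second is at most
`‖f - f₀‖` times a locally bounded mass. -/
lemma continuous_integral_pairing :
    Continuous fun p : FiniteMeasure (USphere n) × C(USphere n, ℝ) =>
      ∫ u, p.2 u ∂(p.1 : Measure (USphere n)) := by
  rw [continuous_iff_continuousAt]
  rintro ⟨μ₀, f₀⟩
  have h1 : Continuous fun p : FiniteMeasure (USphere n) × C(USphere n, ℝ) =>
      ∫ u, f₀ u ∂(p.1 : Measure (USphere n)) :=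
    (FiniteMeasure.continuous_integral_continuousMap f₀).comp continuous_fst
  have h2 : Tendsto (fun p : FiniteMeasure (USphere n) × C(USphere n, ℝ) =>
      ‖p.2 - f₀‖ * (p.1.mass : ℝ)) (𝓝 (μ₀, f₀)) (𝓝 0) := by
    have : Continuous fun p : FiniteMeasure (USphere n) × C(USphere n, ℝ) =>
        ‖p.2 - f₀‖ * (p.1.mass : ℝ) :=
      (by fun_prop : Continuous fun p : FiniteMeasure (USphere n) × C(USphere n, ℝ) =>
        ‖p.2 - f₀‖).mul
        (NNReal.continuous_coe.comp (FiniteMeasure.continuous_mass.comp continuous_fst))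
    simpa using this.tendsto (μ₀, f₀)
  have h3 : Tendsto (fun p : FiniteMeasure (USphere n) × C(USphere n, ℝ) =>
      ∫ u, (p.2 - f₀) u ∂(p.1 : Measure (USphere n))) (𝓝 (μ₀, f₀)) (𝓝 0) := by
    refine squeeze_zero_norm (fun p => ?_) h2
    refine (norm_integral_le_of_norm_le_const
      (Eventually.of_forall fun u => (p.2 - f₀).norm_coe_le_norm u)).trans (le_of_eq ?_)
    rfl
  have h4 := (h1.tendsto (μ₀, f₀)).add h3
  rw [add_zero] at h4
  refine h4.congr fun p => ?_
  rw [← integral_add (integrable_of_continuous f₀.continuous)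
    (integrable_of_continuous (p.2 - f₀).continuous)]
  simp

lemma continuous_integral_of_continuous {X : Type*} [TopologicalSpace X]
    {μ : X → FiniteMeasure (USphere n)} (hμ : Continuous μ) {F : X → USphere n → ℝ}
    (hF : Continuous fun p : X × USphere n => F p.1 p.2) :
    Continuous fun x => ∫ u, F x u ∂(μ x : Measure (USphere n)) :=
  continuous_integral_pairing.comp
    (hμ.prodMk (ContinuousMap.curry ⟨fun p : X × USphere n => F p.1 p.2, hF⟩).continuous)

lemma continuous_integral_sphericalMeasure {X : Type*} [TopologicalSpace X]
    {F : X → USphere n → ℝ} (hF : Continuous fun p : X × USphere n => F p.1 p.2) :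
    Continuous fun x => ∫ u, F x u ∂(sphericalMeasure n) :=
  continuous_integral_of_continuous (μ := fun _ => ⟨sphericalMeasure n, inferInstance⟩)
    continuous_const hF

/-! ### Uniform bounds -/

lemma integral_max_inner_pos {μ : FiniteMeasure (USphere n)}
    (hμ : NotConcentratedOnHemisphere μ) (v : USphere n) :
    0 < ∫ u : USphere n, max (inner ℝ (u : Space n) (v : Space n)) 0
      ∂(μ : Measure (USphere n)) := by
  rw [integral_pos_iff_support_of_nonneg
    (f := fun u : USphere n => max (inner ℝ (u : Space n) (v : Space n)) 0)
    (fun u => le_max_right _ _) (integrable_of_continuous (by fun_prop))]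
  refine pos_iff_ne_zero.2 ?_
  -- The complement of the closed hemisphere of `-v` is exactly where `⟪u, v⟫ > 0`.
  convert hμ (-v) using 2
  ext u
  simp [inner_neg_right]

lemma exists_norm_le_of_orliczIntegral_le [Nonempty (USphere n)] {φ : ℝ → ℝ} (hφ : ClassI φ)
    (hφconv : ConvexOn ℝ (Ioi 0) φ) {μ₀ : FiniteMeasure (USphere n)}
    (hμ₀ : NotConcentratedOnHemisphere μ₀) :
    ∃ R > 0, ∀ᶠ μ in 𝓝 μ₀, ∀ K : ConvexBody (Space n),
      (∀ u, 0 < supportFn (K : Set (Space n)) u) → orliczIntegral φ μ K ≤ μ.mass →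
      ∀ x ∈ K, ‖x‖ ≤ R := by
  let F : FiniteMeasure (USphere n) × USphere n → ℝ := fun p =>
    ∫ u : USphere n, max (inner ℝ (u : Space n) (p.2 : Space n)) 0 ∂(p.1 : Measure (USphere n))
  have hF : Continuous F := continuous_integral_of_continuous continuous_fst
    (F := fun (p : FiniteMeasure (USphere n) × USphere n) (u : USphere n) =>
      max (inner ℝ (u : Space n) (p.2 : Space n)) 0) (by fun_prop)
  obtain ⟨w, -, hw⟩ := isCompact_univ.exists_isMinOn univ_nonempty
    (hF.comp (by fun_prop : Continuous fun v : USphere n => (μ₀, v))).continuousOn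
  have hFw : 0 < F (μ₀, w) := integral_max_inner_pos hμ₀ w
  -- Half the minimum of `F (μ₀, ·)`: by compactness of the sphere it remains a lower bound,
  -- uniformly in `v`, for all measures near `μ₀`.
  let δ := F (μ₀, w) / 2
  have hδ : 0 < δ := half_pos hFw
  have hev : ∀ᶠ μ in 𝓝 μ₀, ∀ v ∈ (univ : Set (USphere n)), δ < F (μ, v) := by
    refine isCompact_univ.eventually_forall_of_forall_eventually fun v _ => ?_
    refine hF.continuousAt.eventually_const_lt ?_
    have : F (μ₀, w) ≤ F (μ₀, v) := hw (mem_univ v)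
    simp only [δ]
    linarith
  have hmass : ∀ᶠ μ : FiniteMeasure (USphere n) in 𝓝 μ₀, (μ.mass : ℝ) < μ₀.mass + 1 :=
    (NNReal.continuous_coe.comp FiniteMeasure.continuous_mass).continuousAt.eventually_lt_const
      (lt_add_one _)
  refine ⟨2 * (μ₀.mass + 1) / δ, by positivity, ?_⟩
  filter_upwards [hev, hmass] with μ hμ hm K hK hobj x hx
  rcases eq_or_ne x 0 with rfl | hx0
  · rw [norm_zero]
    positivity
  have hxpos : 0 < ‖x‖ := norm_pos_iff.2 hx0
  let v : USphere n := ⟨‖x‖⁻¹ • x, by simp [norm_smul, hxpos.ne']⟩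
  -- Here `h_K(u) ≥ ‖x‖ max ⟪u, v⟫ 0`, because `x ∈ K` and `h_K > 0`. Integrating gives `‖x‖ δ ≤ 2
  -- μ.mass`.
  have hpt : ∀ u : USphere n, ‖x‖ * max (inner ℝ (u : Space n) (v : Space n)) 0 - 1 ≤
      φ (supportFn (K : Set (Space n)) u) := by
    intro u
    refine le_trans ?_ (hφ.sub_one_le hφconv (hK u))
    rw [mul_max_of_nonneg _ _ hxpos.le, mul_zero, real_inner_smul_right,
      mul_inv_cancel_left₀ hxpos.ne', real_inner_comm]
    exact sub_le_sub_right (max_le (inner_le_supportFn K u hx) (hK u).le) 1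
  have hint := integral_mono (μ := (μ : Measure (USphere n)))
    (integrable_of_continuous (by fun_prop))
    (integrable_of_continuous (hφ.continuous_comp (continuous_supportFn_right K) hK)) hpt
  rw [integral_sub (integrable_of_continuous (by fun_prop)) (integrable_const _),
    integral_const_mul, integral_const, smul_eq_mul, mul_one] at hint
  have h1 : ‖x‖ * F (μ, v) - μ.mass ≤ orliczIntegral φ μ K := hint
  have h2 : ‖x‖ * δ ≤ ‖x‖ * F (μ, v) := mul_le_mul_of_nonneg_left (hμ v (mem_univ v)).le hxpos.le
  rw [le_div_iff₀ hδ]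
  linarith

/-! ### Existence, uniqueness and stability of minimizers -/

lemma continuous_max_supportFn (r : ℝ) {X : Type*} [TopologicalSpace X]
    {f : X → ConvexBody (Space n)} {g : X → USphere n} (hf : Continuous f) (hg : Continuous g) :
    Continuous fun x => max (supportFn (f x : Set (Space n)) (g x)) r :=
  (continuous_supportFn.comp (hf.prodMk hg)).max continuous_const

lemma isCompact_tildeB_inter {G : ℝ → USphere n → ℝ} (hG : ClassGI G) {r : ℝ} (hr : 0 < r)
    (R : ℝ) :
    IsCompact (tildeB G ∩ {K : ConvexBody (Space n) |
      (∀ x ∈ K, ‖x‖ ≤ R) ∧ ∀ u, r ≤ supportFn (K : Set (Space n)) u}) := by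
  have hpos : ∀ t, 0 < max t r := fun t => lt_max_of_lt_right hr
  -- Truncating `h_K` below at `r` makes the functional continuous on all convex bodies without
  -- changing it where `h_K ≥ r`.
  have hc : Continuous fun K : ConvexBody (Space n) =>
      ∫ u, G (max (supportFn (K : Set (Space n)) u) r)⁻¹ u ∂(sphericalMeasure n) :=
    continuous_integral_sphericalMeasure
      (F := fun (K : ConvexBody (Space n)) u => G (max (supportFn (K : Set (Space n)) u) r)⁻¹ u)
      (hG.continuous_comp
        ((continuous_max_supportFn r continuous_fst continuous_snd).inv₀ fun _ => (hpos _).ne')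
        continuous_snd fun _ => inv_pos.2 (hpos _))
  have hclosed : IsClosed {K : ConvexBody (Space n) |
      ∀ u, r ≤ supportFn (K : Set (Space n)) u} := by
    simp only [ofPred_forall]
    exact isClosed_iInter fun u => isClosed_le continuous_const
      (continuous_supportFn.comp (by fun_prop : Continuous fun K : ConvexBody (Space n) => (K, u)))
  convert (isCompact_setOf_subset_closedBall (n := n) R).inter_right
    (hclosed.inter (isClosed_eq hc
      (continuous_const (y := ∫ u, G 1 u ∂(sphericalMeasure n))))) using 1
  ext K
  simp only [mem_inter_iff, mem_ofPred_eq, mem_tildeB_iff]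
  constructor
  · rintro ⟨⟨-, h⟩, hR, hK⟩
    refine ⟨hR, hK, ?_⟩
    simpa only [max_eq_left (hK _)] using h
  · rintro ⟨hR, hK, h⟩
    refine ⟨⟨fun u => hr.trans_le (hK u), ?_⟩, hR, hK⟩
    simpa only [max_eq_left (hK _)] using h

lemma orliczIntegral_eq_integral_max {φ : ℝ → ℝ} (μ : FiniteMeasure (USphere n))
    {K : ConvexBody (Space n)} {r : ℝ} (hK : ∀ u, r ≤ supportFn (K : Set (Space n)) u) :
    orliczIntegral φ μ K =
      ∫ u, φ (max (supportFn (K : Set (Space n)) u) r) ∂(μ : Measure (USphere n)) := by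
  simp only [orliczIntegral, max_eq_left (hK _)]

lemma continuous_integral_max {φ : ℝ → ℝ} (hφ : ClassI φ) {r : ℝ} (hr : 0 < r) :
    Continuous fun p : FiniteMeasure (USphere n) × ConvexBody (Space n) =>
      ∫ u, φ (max (supportFn (p.2 : Set (Space n)) u) r) ∂(p.1 : Measure (USphere n)) :=
  continuous_integral_of_continuous continuous_fst
    (F := fun (p : FiniteMeasure (USphere n) × ConvexBody (Space n)) u =>
      φ (max (supportFn (p.2 : Set (Space n)) u) r))
    (hφ.continuous_comp
      (continuous_max_supportFn r (continuous_snd.comp continuous_fst) continuous_snd)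
      fun _ => lt_max_of_lt_right hr)

lemma exists_bounds_of_orliczIntegral_le [Nonempty (USphere n)] {φ : ℝ → ℝ} (hφ : ClassI φ)
    (hφconv : ConvexOn ℝ (Ioi 0) φ) {G : ℝ → USphere n → ℝ} (hG : ClassGI G) {p : ℕ}
    (hp : 1 ≤ p) (hnp : n - 1 ≤ p) (hgrowth : HasPowerGrowth G p)
    {μ₀ : FiniteMeasure (USphere n)} (hμ₀ : NotConcentratedOnHemisphere μ₀) :
    ∃ r > 0, ∃ R, ∀ᶠ μ in 𝓝 μ₀, ∀ K ∈ tildeB G, orliczIntegral φ μ K ≤ μ.mass →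
      (∀ x ∈ K, ‖x‖ ≤ R) ∧ ∀ u, r ≤ supportFn (K : Set (Space n)) u := by
  obtain ⟨R, hR, hev⟩ := exists_norm_le_of_orliczIntegral_le hφ hφconv hμ₀
  obtain ⟨r, hr, hrK⟩ := exists_le_supportFn_of_integral_le hG hp hnp hgrowth hR
    (∫ u, G 1 u ∂(sphericalMeasure n))
  refine ⟨r, hr, R, hev.mono fun μ hμ K hK hobj => ?_⟩
  obtain ⟨hpos, hvol⟩ := (mem_tildeB_iff K).1 hK
  exact ⟨hμ K hpos hobj, hrK K (hμ K hpos hobj) hpos hvol.le⟩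

lemma exists_isSolution [Nonempty (USphere n)] {φ : ℝ → ℝ} (hφ : ClassI φ)
    (hφconv : ConvexOn ℝ (Ioi 0) φ) {G : ℝ → USphere n → ℝ} (hG : ClassGI G) {p : ℕ}
    (hp : 1 ≤ p) (hnp : n - 1 ≤ p) (hgrowth : HasPowerGrowth G p)
    {μ : FiniteMeasure (USphere n)} (hμ : NotConcentratedOnHemisphere μ) :
    ∃ M, IsSolution φ μ (tildeB G) M := by
  obtain ⟨r, hr, R, hev⟩ := exists_bounds_of_orliczIntegral_le hφ hφconv hG hp hnp hgrowth hμ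
  have hμK := hev.self_of_nhds
  have hball := hμK _ (unitBall_mem_tildeB G) (orliczIntegral_unitBall hφ μ).le
  obtain ⟨M, ⟨hM, hMr⟩, hmin⟩ := (isCompact_tildeB_inter hG hr R).exists_isMinOn
    ⟨_, unitBall_mem_tildeB G, hball⟩
    ((continuous_integral_max hφ hr).comp
      (by fun_prop : Continuous fun K : ConvexBody (Space n) => (μ, K))).continuousOn
  have hmin' : ∀ Q ∈ tildeB G, orliczIntegral φ μ Q ≤ μ.mass →
      orliczIntegral φ μ M ≤ orliczIntegral φ μ Q := by
    intro Q hQ hobj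
    have hQr := hμK Q hQ hobj
    rw [orliczIntegral_eq_integral_max μ hMr.2, orliczIntegral_eq_integral_max μ hQr.2]
    exact hmin ⟨hQ, hQr⟩
  refine ⟨M, (isSolution_iff hφ).2 ⟨hM, fun Q hQ => ?_⟩⟩
  rcases le_total (orliczIntegral φ μ Q) μ.mass with h | h
  · exact hmin' Q hQ h
  · refine le_trans ?_ h
    rw [← orliczIntegral_unitBall hφ μ]
    exact hmin' _ (unitBall_mem_tildeB G) (orliczIntegral_unitBall hφ μ).le

lemma integral_lt_integral_of_continuous {μ : FiniteMeasure (USphere n)} (hμ : μ ≠ 0)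
    {f g : USphere n → ℝ} (hf : Continuous f) (hg : Continuous g) (h : ∀ u, f u < g u) :
    ∫ u, f u ∂(μ : Measure (USphere n)) < ∫ u, g u ∂(μ : Measure (USphere n)) := by
  rw [← sub_pos, ← integral_sub (integrable_of_continuous hg) (integrable_of_continuous hf),
    integral_pos_iff_support_of_nonneg (fun u => (sub_pos.2 (h u)).le)
      (integrable_of_continuous (hg.sub hf)),
    show Function.support (fun u => g u - f u) = univ from
      eq_univ_of_forall fun u => (sub_pos.2 (h u)).ne', ← FiniteMeasure.ennreal_mass]
  exact_mod_cast pos_iff_ne_zero.2 ((FiniteMeasure.mass_nonzero_iff μ).2 hμ)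

/-- A body whose polar has smaller general dual volume than the unit ball can be shrunk to an
admissible one. -/
lemma exists_smul_mem_tildeB [Nonempty (USphere n)] {G : ℝ → USphere n → ℝ} (hG : ClassGI G)
    (N : ConvexBody (Space n)) (hN : ∀ u, 0 < supportFn (N : Set (Space n)) u)
    (hlt : ∫ u, G (supportFn (N : Set (Space n)) u)⁻¹ u ∂(sphericalMeasure n) <
      ∫ u, G 1 u ∂(sphericalMeasure n)) :
    ∃ c : ℝ, 0 < c ∧ c < 1 ∧ c • N ∈ tildeB G := by
  obtain ⟨w, -, hw⟩ := isCompact_univ.exists_isMaxOn univ_nonempty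
    (continuous_supportFn_right N).continuousOn
  let h : USphere n → ℝ := fun u => supportFn (N : Set (Space n)) u
  -- At scale `a` the body has `a h ≤ 1`, so its polar has dual volume at least that of the ball; at
  -- scale `1` it has less. The intermediate value theorem gives `c`.
  let a : ℝ := (max 1 (h w))⁻¹
  have hmax : 0 < max 1 (h w) := lt_max_of_lt_left one_pos
  have ha : 0 < a := inv_pos.2 hmax
  have ha1 : a ≤ 1 := inv_le_one_of_one_le₀ (le_max_left _ _)
  have hpos : ∀ p : ℝ × USphere n, 0 < max p.1 a * h p.2 := fun p =>
    mul_pos (lt_max_of_lt_right ha) (hN _)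
  let V : ℝ → ℝ := fun c => ∫ u, G (max c a * h u)⁻¹ u ∂(sphericalMeasure n)
  have hV : Continuous V := continuous_integral_sphericalMeasure
    (F := fun (c : ℝ) u => G (max c a * h u)⁻¹ u)
    (hG.continuous_comp
      ((((continuous_fst.max continuous_const).mul
        ((continuous_supportFn_right N).comp continuous_snd))).inv₀ fun p => (hpos p).ne')
      continuous_snd fun p => inv_pos.2 (hpos p))
  have hV1 : V 1 < ∫ u, G 1 u ∂(sphericalMeasure n) := by
    simpa only [V, max_eq_left ha1, one_mul] using hlt
  have hVa : ∫ u, G 1 u ∂(sphericalMeasure n) ≤ V a := by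
    refine integral_mono
      (integrable_of_continuous
        (hG.continuous_comp continuous_const continuous_id fun _ => one_pos))
      (integrable_of_continuous (hG.continuous_comp
        ((continuous_const.mul (continuous_supportFn_right N)).inv₀ fun u => (hpos (a, u)).ne')
        continuous_id fun u => inv_pos.2 (hpos (a, u)))) fun u => ?_
    have hle : max a a * h u ≤ 1 := by
      rw [max_self, inv_mul_le_one₀ hmax]
      exact le_max_of_le_right (hw (mem_univ u))
    exact (hG.strictMonoOn u).monotoneOn (mem_Ioi.2 one_pos) (inv_pos.2 (hpos (a, u)))
      ((one_le_inv₀ (hpos (a, u))).2 hle)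
  obtain ⟨c, hc, hVc⟩ := intermediate_value_Icc' ha1 hV.continuousOn ⟨hV1.le, hVa⟩
  have hc0 : 0 < c := ha.trans_le hc.1
  refine ⟨c, hc0, lt_of_le_of_ne hc.2 ?_, ?_⟩
  · rintro rfl
    exact hV1.ne hVc
  · rw [mem_tildeB_iff]
    simp only [supportFn_smul N _ hc0.le]
    refine ⟨fun u => mul_pos hc0 (hN u), ?_⟩
    simpa only [V, max_eq_left hc.1] using hVc

lemma inv_midpoint_le {s t : ℝ} (hs : 0 < s) (ht : 0 < t) :
    ((s + t) / 2)⁻¹ ≤ (s⁻¹ + t⁻¹) / 2 := by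
  rw [inv_eq_one_div, div_le_div_iff₀ (by positivity) two_pos]
  have : s⁻¹ + t⁻¹ = (s + t) / (s * t) := by
    field_simp
    ring
  rw [this, div_mul_div_comm, one_mul, le_div_iff₀ (by positivity)]
  nlinarith [sq_nonneg (s - t)]

lemma inv_midpoint_lt {s t : ℝ} (hs : 0 < s) (ht : 0 < t) (hst : s ≠ t) :
    ((s + t) / 2)⁻¹ < (s⁻¹ + t⁻¹) / 2 := by
  rw [inv_eq_one_div, div_lt_div_iff₀ (by positivity) two_pos]
  have : s⁻¹ + t⁻¹ = (s + t) / (s * t) := by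
    field_simp
    ring
  rw [this, div_mul_div_comm, one_mul, lt_div_iff₀ (by positivity)]
  nlinarith [sq_pos_of_pos (abs_pos.2 (sub_ne_zero.2 hst)), sq_abs (s - t)]

lemma convexOn_midpoint_le {f : ℝ → ℝ} {S : Set ℝ} (hf : ConvexOn ℝ S f) {s t : ℝ}
    (hs : s ∈ S) (ht : t ∈ S) : f ((s + t) / 2) ≤ (f s + f t) / 2 := by
  have := hf.2 hs ht (by norm_num : (0 : ℝ) ≤ 1 / 2) (by norm_num : (0 : ℝ) ≤ 1 / 2) (by norm_num)
  simp only [smul_eq_mul] at this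
  rw [show (s + t) / 2 = 1 / 2 * s + 1 / 2 * t by ring]
  linarith

/-- The general dual volume of the polar of a Minkowski average of two distinct admissible bodies
is smaller than that of the unit ball. -/
lemma integral_midpoint_lt {G : ℝ → USphere n → ℝ} (hG : ClassGI G)
    (hconv : ∀ u, ConvexOn ℝ (Ioi 0) (fun t => G t u)) {K L : ConvexBody (Space n)}
    (hK : K ∈ tildeB G) (hL : L ∈ tildeB G) (hne : K ≠ L) :
    ∫ u, G ((supportFn (K : Set (Space n)) u + supportFn (L : Set (Space n)) u) / 2)⁻¹ u
      ∂(sphericalMeasure n) < ∫ u, G 1 u ∂(sphericalMeasure n) := by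
  obtain ⟨hK0, hKV⟩ := (mem_tildeB_iff K).1 hK
  obtain ⟨hL0, hLV⟩ := (mem_tildeB_iff L).1 hL
  let k : USphere n → ℝ := fun u => supportFn (K : Set (Space n)) u
  let l : USphere n → ℝ := fun u => supportFn (L : Set (Space n)) u
  have hkc : Continuous k := continuous_supportFn_right K
  have hlc : Continuous l := continuous_supportFn_right L
  have hm0 : ∀ u, 0 < (k u + l u) / 2 := fun u => half_pos (add_pos (hK0 u) (hL0 u))
  have hcK : Continuous fun u => G (k u)⁻¹ u :=
    hG.continuous_comp (hkc.inv₀ fun u => (hK0 u).ne') continuous_id fun u => inv_pos.2 (hK0 u)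
  have hcL : Continuous fun u => G (l u)⁻¹ u :=
    hG.continuous_comp (hlc.inv₀ fun u => (hL0 u).ne') continuous_id fun u => inv_pos.2 (hL0 u)
  have hcm : Continuous fun u => G ((k u + l u) / 2)⁻¹ u :=
    hG.continuous_comp (((hkc.add hlc).div_const 2).inv₀ fun u => (hm0 u).ne') continuous_id
      fun u => inv_pos.2 (hm0 u)
  have hi0 : ∀ u, 0 < ((k u)⁻¹ + (l u)⁻¹) / 2 := fun u =>
    half_pos (add_pos (inv_pos.2 (hK0 u)) (inv_pos.2 (hL0 u)))
  have hmid : ∀ u, G (((k u)⁻¹ + (l u)⁻¹) / 2) u ≤ (G (k u)⁻¹ u + G (l u)⁻¹ u) / 2 := fun u =>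
    convexOn_midpoint_le (hconv u) (inv_pos.2 (hK0 u)) (inv_pos.2 (hL0 u))
  have hle : ∀ u, G ((k u + l u) / 2)⁻¹ u ≤ (G (k u)⁻¹ u + G (l u)⁻¹ u) / 2 := fun u =>
    ((hG.strictMonoOn u).monotoneOn (inv_pos.2 (hm0 u)) (hi0 u)
      (inv_midpoint_le (hK0 u) (hL0 u))).trans (hmid u)
  -- Strictness at one direction suffices: by continuity it holds on an open set, which has positive
  -- spherical measure.
  obtain ⟨v, hv⟩ : ∃ v, k v ≠ l v := by
    by_contra! h
    exact hne (eq_of_supportFn_eq h)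
  have hltv : G ((k v + l v) / 2)⁻¹ v < (G (k v)⁻¹ v + G (l v)⁻¹ v) / 2 :=
    (hG.strictMonoOn v (inv_pos.2 (hm0 v)) (hi0 v)
      (inv_midpoint_lt (hK0 v) (hL0 v) hv)).trans_le (hmid v)
  have hcs : Continuous fun u => (G (k u)⁻¹ u + G (l u)⁻¹ u) / 2 := (hcK.add hcL).div_const 2
  have hdiff : 0 < ∫ u, ((G (k u)⁻¹ u + G (l u)⁻¹ u) / 2 - G ((k u + l u) / 2)⁻¹ u)
      ∂(sphericalMeasure n) :=
    (hcs.sub hcm).integral_pos_of_hasCompactSupport_nonneg_nonzero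
      (HasCompactSupport.of_compactSpace _) (fun u => sub_nonneg.2 (hle u)) (sub_pos.2 hltv).ne'
  rw [integral_sub (integrable_of_continuous hcs)
    (integrable_of_continuous hcm), integral_div,
    integral_add (integrable_of_continuous hcK) (integrable_of_continuous hcL)] at hdiff
  simp only [k, l] at hdiff
  rw [hKV, hLV] at hdiff
  linarith

/-- The midpoint body does no worse than the minimum, and it leaves room to shrink by some `c < 1`;
shrinking strictly lowers the objective since `φ` is strictly increasing and `μ ≠ 0`. -/
lemma IsSolution.eq [Nonempty (USphere n)] {φ : ℝ → ℝ} (hφ : ClassI φ)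
    (hφconv : ConvexOn ℝ (Ioi 0) φ) {G : ℝ → USphere n → ℝ} (hG : ClassGI G)
    (hconv : ∀ u, ConvexOn ℝ (Ioi 0) (fun t => G t u))
    {μ : FiniteMeasure (USphere n)} (hμ : μ ≠ 0) {K L : ConvexBody (Space n)}
    (hK : IsSolution φ μ (tildeB G) K) (hL : IsSolution φ μ (tildeB G) L) : K = L := by
  by_contra hne
  rw [isSolution_iff hφ] at hK hL
  have hK0 := ((mem_tildeB_iff K).1 hK.1).1
  have hL0 := ((mem_tildeB_iff L).1 hL.1).1
  let N : ConvexBody (Space n) := (2⁻¹ : ℝ) • (K + L)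
  have hN : ∀ u, supportFn (N : Set (Space n)) u =
      (supportFn (K : Set (Space n)) u + supportFn (L : Set (Space n)) u) / 2 := fun u => by
    rw [supportFn_smul _ _ (by norm_num), supportFn_add]
    ring
  have hN0 : ∀ u, 0 < supportFn (N : Set (Space n)) u := fun u => by
    rw [hN]
    exact half_pos (add_pos (hK0 u) (hL0 u))
  obtain ⟨c, hc0, hc1, hcN⟩ := exists_smul_mem_tildeB hG N hN0
    (by simpa only [hN] using integral_midpoint_lt hG hconv hK.1 hL.1 hne)
  have hcont : ∀ Q : ConvexBody (Space n), (∀ u, 0 < supportFn (Q : Set (Space n)) u) →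
      Continuous fun u => φ (supportFn (Q : Set (Space n)) u) := fun Q hQ =>
    hφ.continuous_comp (continuous_supportFn_right Q) hQ
  have h1 : orliczIntegral φ μ (c • N) < orliczIntegral φ μ N := by
    refine integral_lt_integral_of_continuous hμ (hcont _ ((mem_tildeB_iff _).1 hcN).1)
      (hcont N hN0) fun u => ?_
    rw [supportFn_smul N u hc0.le]
    exact hφ.strictMonoOn (mul_pos hc0 (hN0 u)) (hN0 u) (mul_lt_of_lt_one_left (hN0 u) hc1)
  have h2 : orliczIntegral φ μ N ≤ (orliczIntegral φ μ K + orliczIntegral φ μ L) / 2 := by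
    have hcs : Continuous fun u =>
        (φ (supportFn (K : Set (Space n)) u) + φ (supportFn (L : Set (Space n)) u)) / 2 :=
      ((hcont K hK0).add (hcont L hL0)).div_const 2
    have hint := integral_mono (μ := (μ : Measure (USphere n)))
      (integrable_of_continuous (hcont N hN0)) (integrable_of_continuous hcs) fun u => by
        simp only [hN]
        exact convexOn_midpoint_le hφconv (hK0 u) (hL0 u)
    rw [integral_div, integral_add (integrable_of_continuous (hcont K hK0))
      (integrable_of_continuous (hcont L hL0))] at hint
    exact hint
  linarith [hK.2 _ hcN, hL.2 _ hcN]

lemma tendsto_of_isSolution [Nonempty (USphere n)] {φ : ℝ → ℝ} (hφ : ClassI φ)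
    (hφconv : ConvexOn ℝ (Ioi 0) φ) {G : ℝ → USphere n → ℝ} (hG : ClassGI G)
    (hconv : ∀ u, ConvexOn ℝ (Ioi 0) (fun t => G t u)) {p : ℕ}
    (hp : 1 ≤ p) (hnp : n - 1 ≤ p) (hgrowth : HasPowerGrowth G p)
    {μ : ℕ → FiniteMeasure (USphere n)} {μ₀ : FiniteMeasure (USphere n)} (hμ₀ : μ₀ ≠ 0)
    (hμ₀H : NotConcentratedOnHemisphere μ₀) (hlim : Tendsto μ atTop (𝓝 μ₀))
    {M : ℕ → ConvexBody (Space n)} {M₀ : ConvexBody (Space n)}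
    (hM : ∀ i, IsSolution φ (μ i) (tildeB G) (M i)) (hM₀ : IsSolution φ μ₀ (tildeB G) M₀) :
    Tendsto M atTop (𝓝 M₀) := by
  obtain ⟨r, hr, R, hev⟩ := exists_bounds_of_orliczIntegral_le hφ hφconv hG hp hnp hgrowth hμ₀H
  have hmass : ∀ {ν : FiniteMeasure (USphere n)} {K : ConvexBody (Space n)},
      IsSolution φ ν (tildeB G) K → orliczIntegral φ ν K ≤ ν.mass := fun {ν} {K} hK => by
    rw [← orliczIntegral_unitBall hφ ν]
    exact ((isSolution_iff hφ).1 hK).2 _ (unitBall_mem_tildeB G)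
  have hM₀r := hev.self_of_nhds M₀ hM₀.1 (hmass hM₀)
  have hMr : ∀ᶠ i in atTop, M i ∈ tildeB G ∩ {K : ConvexBody (Space n) |
      (∀ x ∈ K, ‖x‖ ≤ R) ∧ ∀ u, r ≤ supportFn (K : Set (Space n)) u} :=
    (hlim.eventually hev).mono fun i hi => ⟨(hM i).1, hi _ (hM i).1 (hmass (hM i))⟩
  -- In a compact set, convergence reduces to identifying every cluster point `N`. Passing to the
  -- limit in the comparison of `M (ψ i)` with `M₀` shows that `N` is also a minimizer for `μ₀`.
  refine (isCompact_tildeB_inter hG hr R).tendsto_nhds_of_unique_mapClusterPt hMr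
    fun N hN hcl => ?_
  obtain ⟨ψ, hψ, hψN⟩ := hcl.tendsto_subseq
  have hH := continuous_integral_max (n := n) hφ hr
  have h1 := (hH.tendsto (μ₀, N)).comp ((hlim.comp hψ.tendsto_atTop).prodMk_nhds hψN)
  have h2 := (hH.tendsto (μ₀, M₀)).comp
    ((hlim.comp hψ.tendsto_atTop).prodMk_nhds (tendsto_const_nhds (x := M₀)))
  have hle := le_of_tendsto_of_tendsto h1 h2 <| by
    filter_upwards [hψ.tendsto_atTop.eventually hMr] with i hi
    have := ((isSolution_iff hφ).1 (hM (ψ i))).2 M₀ hM₀.1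
    rwa [orliczIntegral_eq_integral_max _ hi.2.2, orliczIntegral_eq_integral_max _ hM₀r.2] at this
  have hle' : orliczIntegral φ μ₀ N ≤ orliczIntegral φ μ₀ M₀ := by
    rw [orliczIntegral_eq_integral_max _ hN.2.2, orliczIntegral_eq_integral_max _ hM₀r.2]
    exact hle
  exact IsSolution.eq hφ hφconv hG hconv hμ₀ ((isSolution_iff hφ).2 ⟨hN.1, fun Q hQ =>
    hle'.trans (((isSolution_iff hφ).1 hM₀).2 Q hQ)⟩) hM₀

/-- Existence, uniqueness and stability of the minimizers over `tildeB G`. -/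
theorem existsUnique_isSolution_and_tendsto [Nonempty (USphere n)] {φ : ℝ → ℝ} (hφ : ClassI φ)
    (hφconv : ConvexOn ℝ (Ioi 0) φ) {G : ℝ → USphere n → ℝ} (hG : ClassGI G)
    (hconv : ∀ u, ConvexOn ℝ (Ioi 0) (fun t => G t u)) {p : ℕ}
    (hp : 1 ≤ p) (hnp : n - 1 ≤ p) (hgrowth : HasPowerGrowth G p)
    {μ : ℕ → FiniteMeasure (USphere n)} {μ₀ : FiniteMeasure (USphere n)}
    (hμ : ∀ i, μ i ≠ 0) (hμ₀ : μ₀ ≠ 0) (hμH : ∀ i, NotConcentratedOnHemisphere (μ i))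
    (hμ₀H : NotConcentratedOnHemisphere μ₀) (hlim : Tendsto μ atTop (𝓝 μ₀)) :
    (∃! M, IsSolution φ μ₀ (tildeB G) M) ∧ (∀ i, ∃! M, IsSolution φ (μ i) (tildeB G) M) ∧
      ∀ (M : ℕ → ConvexBody (Space n)) (M₀ : ConvexBody (Space n)),
        (∀ i, IsSolution φ (μ i) (tildeB G) (M i)) → IsSolution φ μ₀ (tildeB G) M₀ →
        Tendsto M atTop (𝓝 M₀) := by
  have key : ∀ ν : FiniteMeasure (USphere n), ν ≠ 0 → NotConcentratedOnHemisphere ν →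
      ∃! M, IsSolution φ ν (tildeB G) M := fun ν hν hνH =>
    existsUnique_of_exists_of_unique (exists_isSolution hφ hφconv hG hp hnp hgrowth hνH)
      fun _ _ => IsSolution.eq hφ hφconv hG hconv hν
  exact ⟨key μ₀ hμ₀ hμ₀H, fun i => key (μ i) (hμ i) (hμH i), fun _ _ =>
    tendsto_of_isSolution hφ hφconv hG hconv hp hnp hgrowth hμ₀ hμ₀H hlim⟩

/-! ### The homogeneous general dual volume -/

/-- Scaling of the first variable of `G`. -/
def rescale (G : ℝ → USphere n → ℝ) (a : ℝ) : ℝ → USphere n → ℝ := fun t u => G (t / a) u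

lemma ClassGI.rescale {G : ℝ → USphere n → ℝ} (hG : ClassGI G) {a : ℝ} (ha : 0 < a) :
    ClassGI (rescale G a) where
  continuousOn := hG.continuousOn.comp
    (f := fun p : ℝ × USphere n => (p.1 / a, p.2)) (by fun_prop)
    fun _ hp => ⟨div_pos hp.1 ha, mem_univ _⟩
  pos _ ht := hG.pos _ (div_pos ht ha)
  strictMonoOn u _ hs _ ht hst := hG.strictMonoOn u (div_pos hs ha) (div_pos ht ha)
    (div_lt_div_of_pos_right hst ha)
  tendsto_zero u := by
    refine (hG.tendsto_zero u).comp (tendsto_nhdsWithin_iff.2 ⟨?_, ?_⟩)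
    · have : Tendsto (fun t : ℝ => t / a) (𝓝 0) (𝓝 (0 / a)) := tendsto_id.div_const a
      rw [zero_div] at this
      exact this.mono_left nhdsWithin_le_nhds
    · filter_upwards [self_mem_nhdsWithin] with t ht using div_pos ht ha
  tendsto_atTop u := (hG.tendsto_atTop u).comp (tendsto_id.atTop_div_const ha)

lemma convexOn_rescale {G : ℝ → USphere n → ℝ} {a : ℝ} (ha : 0 < a) {u : USphere n}
    (h : ConvexOn ℝ (Ioi 0) (fun t => G t u)) :
    ConvexOn ℝ (Ioi 0) (fun t => rescale G a t u) := by
  refine ⟨convex_Ioi 0, fun s hs t ht b c hb hc hbc => ?_⟩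
  have := h.2 (div_pos hs ha) (div_pos ht ha) hb hc hbc
  simp only [rescale, smul_eq_mul] at this ⊢
  rwa [show (b * s + c * t) / a = b * (s / a) + c * (t / a) by ring]

lemma HasPowerGrowth.rescale {G : ℝ → USphere n → ℝ} {p : ℕ} (h : HasPowerGrowth G p) {a : ℝ}
    (ha : 0 < a) : HasPowerGrowth (rescale G a) p := by
  obtain ⟨c, hc, T, hT, h⟩ := h
  refine ⟨c / a ^ p, by positivity, T * a, by positivity, fun t ht u => ?_⟩
  have := h (t / a) ((le_div_iff₀ ha).2 ht) u
  rwa [div_pow, mul_div_assoc', ← div_mul_eq_mul_div] at this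

section scaling

variable [Nonempty (USphere n)] {G : ℝ → USphere n → ℝ} {f : USphere n → ℝ}

lemma ClassGI.integral_div_strictAnti (hG : ClassGI G) (hf : Continuous f) (hpos : ∀ u, 0 < f u)
    {s t : ℝ} (hs : 0 < s) (hst : s < t) :
    ∫ u, G (f u / t) u ∂(sphericalMeasure n) < ∫ u, G (f u / s) u ∂(sphericalMeasure n) := by
  have ht := hs.trans hst
  have hc : ∀ {r : ℝ}, 0 < r → Continuous fun u => G (f u / r) u := fun {r} hr =>
    hG.continuous_comp (hf.div_const r) continuous_id fun u => div_pos (hpos u) hr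
  have hlt : ∀ u, G (f u / t) u < G (f u / s) u := fun u =>
    hG.strictMonoOn u (div_pos (hpos u) ht) (div_pos (hpos u) hs)
      (div_lt_div_of_pos_left (hpos u) hs hst)
  obtain ⟨v⟩ := ‹Nonempty (USphere n)›
  have := ((hc hs).sub (hc ht)).integral_pos_of_hasCompactSupport_nonneg_nonzero
    (μ := sphericalMeasure n) (HasCompactSupport.of_compactSpace _)
    (fun u => sub_nonneg.2 (hlt u).le) (x := v) (sub_pos.2 (hlt v)).ne'
  rwa [integral_sub' (integrable_of_continuous (hc hs)) (integrable_of_continuous (hc ht)),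
    sub_pos] at this

lemma ClassGI.exists_integral_div_eq_one (hG : ClassGI G)
    (hconv : ∀ u, ConvexOn ℝ (Ioi 0) (fun t => G t u)) (hf : Continuous f)
    (hpos : ∀ u, 0 < f u) :
    ∃ η > 0, ∫ u, G (f u / η) u ∂(sphericalMeasure n) = 1 := by
  let V : ℝ → ℝ := fun η => ∫ u, G (f u / η) u ∂(sphericalMeasure n)
  have hc : ∀ {r : ℝ}, 0 < r → Continuous fun u => G (f u / r) u := fun {r} hr =>
    hG.continuous_comp (hf.div_const r) continuous_id fun u => div_pos (hpos u) hr
  -- Since `G(τ, u)/τ` is nondecreasing in `τ`, `η V(η)` is nonincreasing. Comparison with `V 1`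
  -- then brackets the value `1` between `min 1 (V 1)` and `max 1 (V 1)`.
  have hmul : ∀ {s t : ℝ}, 0 < s → s ≤ t → t * V t ≤ s * V s := by
    intro s t hs hst
    have ht := hs.trans_le hst
    simp only [V]
    rw [← integral_const_mul, ← integral_const_mul]
    refine integral_mono ((integrable_of_continuous (hc ht)).const_mul t)
      ((integrable_of_continuous (hc hs)).const_mul s) fun u => ?_
    have h := mul_le_mul_of_convexOn_Ioi (hconv u) (hG.tendsto_zero u) (div_pos (hpos u) ht)
      (div_le_div_of_nonneg_left (hpos u).le hs hst)
    rw [div_mul_eq_mul_div, div_mul_eq_mul_div, div_le_div_iff₀ hs ht, mul_assoc, mul_assoc] at h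
    have h' := le_of_mul_le_mul_left h (hpos u)
    simp only
    linarith
  have hV1 : 0 < V 1 := by
    simpa only [V, div_one] using hG.integral_pos hf hpos
  let a : ℝ := min 1 (V 1)
  have ha : 0 < a := lt_min one_pos hV1
  let b : ℝ := max 1 (V 1)
  have hb : 0 < b := lt_max_of_lt_left one_pos
  have hab : a ≤ b := (min_le_left _ _).trans (le_max_left _ _)
  have hVa : 1 ≤ V a := by
    have h1 := hmul ha (min_le_left 1 (V 1))
    have h2 : a ≤ V 1 := min_le_right _ _
    rw [one_mul] at h1
    exact le_of_mul_le_mul_left (by linarith) ha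
  have hVb : V b ≤ 1 := by
    have h1 := hmul one_pos (le_max_left 1 (V 1))
    have h2 : V 1 ≤ b := le_max_right _ _
    rw [one_mul] at h1
    exact le_of_mul_le_mul_left (by linarith) hb
  have hVc : ContinuousOn V (Icc a b) := by
    have hpos' : ∀ p : ℝ × USphere n, 0 < max p.1 a := fun p => lt_max_of_lt_right ha
    have : Continuous fun η : ℝ => ∫ u, G (f u / max η a) u ∂(sphericalMeasure n) :=
      continuous_integral_sphericalMeasure (F := fun (η : ℝ) u => G (f u / max η a) u)
        (hG.continuous_comp ((hf.comp continuous_snd).div (continuous_fst.max continuous_const)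
          fun p => (hpos' p).ne') continuous_snd fun p => div_pos (hpos _) (hpos' p))
    refine this.continuousOn.congr fun η hη => ?_
    simp only [V, max_eq_left hη.1]
  obtain ⟨η, hη, hVη⟩ := intermediate_value_Icc' hab hVc ⟨hVb, hVa⟩
  exact ⟨η, ha.trans_le hη.1, hVη⟩

/-- The integral is strictly decreasing in `η` and takes the value `1`, so the infimum is attained
at the unique root. -/
lemma ClassGI.sInf_eq_iff (hG : ClassGI G)
    (hconv : ∀ u, ConvexOn ℝ (Ioi 0) (fun t => G t u)) (hf : Continuous f)
    (hpos : ∀ u, 0 < f u) {a : ℝ} :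
    sInf {η : ℝ | 0 < η ∧ ∫ u, G (f u / η) u ∂(sphericalMeasure n) ≤ 1} = a ↔
      0 < a ∧ ∫ u, G (f u / a) u ∂(sphericalMeasure n) = 1 := by
  have key : ∀ b : ℝ, 0 < b → ∫ u, G (f u / b) u ∂(sphericalMeasure n) = 1 →
      sInf {η : ℝ | 0 < η ∧ ∫ u, G (f u / η) u ∂(sphericalMeasure n) ≤ 1} = b := by
    intro b hb hVb
    refine IsLeast.csInf_eq ⟨⟨hb, hVb.le⟩, fun η hη => ?_⟩
    by_contra! hlt
    have := hG.integral_div_strictAnti hf hpos hη.1 hlt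
    linarith [hη.2]
  refine ⟨?_, fun h => key a h.1 h.2⟩
  rintro rfl
  obtain ⟨b, hb, hVb⟩ := hG.exists_integral_div_eq_one hconv hf hpos
  rw [key b hb hVb]
  exact ⟨hb, hVb⟩

lemma ClassGI.hatB_eq_tildeB_rescale (hG : ClassGI G)
    (hconv : ∀ u, ConvexOn ℝ (Ioi 0) (fun t => G t u)) :
    ∃ a > 0, hatB G = tildeB (DualPolar.rescale G a) := by
  obtain ⟨a, ha⟩ : ∃ a, homDualVolume G (Metric.closedBall (0 : Space n) 1) = a := ⟨_, rfl⟩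
  have ha' := ha
  simp only [homDualVolume, radialFn_closedBall] at ha'
  obtain ⟨ha0, ha1⟩ := (hG.sInf_eq_iff hconv continuous_const fun _ => one_pos).1 ha'
  refine ⟨a, ha0, ?_⟩
  ext K
  rw [mem_tildeB_iff, hatB, mem_ofPred_eq, zero_mem_interior_iff, ha]
  refine and_congr_right fun hK => ?_
  simp only [homDualVolume, radialFn_polarBody K _ (hK _), DualPolar.rescale]
  rw [hG.sInf_eq_iff (f := fun u => (supportFn (K : Set (Space n)) u)⁻¹) hconv
    ((continuous_supportFn_right K).inv₀ fun u => (hK u).ne') fun u => inv_pos.2 (hK u), ha1]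
  exact and_iff_right ha0

end scaling

end

end DualPolar

/-- Existence, uniqueness and continuous dependence on the measure (weak convergence of measures,
Hausdorff convergence of bodies) of the minimizers, for both normalizations. -/
theorem mainTheorem2 (n : ℕ)
    (μ : ℕ → FiniteMeasure (DualPolar.USphere n)) (μ₀ : FiniteMeasure (DualPolar.USphere n))
    (hμ : ∀ i, μ i ≠ 0) (hμ₀ : μ₀ ≠ 0)
    (hμH : ∀ i, DualPolar.NotConcentratedOnHemisphere (μ i))
    (hμ₀H : DualPolar.NotConcentratedOnHemisphere μ₀)
    (hlim : Tendsto μ atTop (𝓝 μ₀))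
    (G : ℝ → DualPolar.USphere n → ℝ) (hG : DualPolar.ClassGI G)
    (hGconv : ∀ u, ConvexOn ℝ (Ioi 0) (fun t => G t u))
    (hGgrowth : ∃ q : ℝ, (n : ℝ) - 1 ≤ q ∧ DualPolar.GrowthCondition G q)
    (φ : ℝ → ℝ) (hφ : DualPolar.ClassI φ) (hφconv : ConvexOn ℝ (Ioi 0) φ) :
    ((∃! M, DualPolar.IsSolution φ μ₀ (DualPolar.tildeB G) M) ∧
      (∀ i, ∃! M, DualPolar.IsSolution φ (μ i) (DualPolar.tildeB G) M) ∧
      ∀ (M : ℕ → ConvexBody (DualPolar.Space n)) (M₀ : ConvexBody (DualPolar.Space n)),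
        (∀ i, DualPolar.IsSolution φ (μ i) (DualPolar.tildeB G) (M i)) →
        DualPolar.IsSolution φ μ₀ (DualPolar.tildeB G) M₀ →
        Tendsto M atTop (𝓝 M₀)) ∧
    ((∃! M, DualPolar.IsSolution φ μ₀ (DualPolar.hatB G) M) ∧
      (∀ i, ∃! M, DualPolar.IsSolution φ (μ i) (DualPolar.hatB G) M) ∧
      ∀ (M : ℕ → ConvexBody (DualPolar.Space n)) (M₀ : ConvexBody (DualPolar.Space n)),
        (∀ i, DualPolar.IsSolution φ (μ i) (DualPolar.hatB G) (M i)) →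
        DualPolar.IsSolution φ μ₀ (DualPolar.hatB G) M₀ →
        Tendsto M atTop (𝓝 M₀)) := by
  -- An empty sphere (`n = 0`) carries only the zero measure.
  have : Nonempty (DualPolar.USphere n) := by
    by_contra h
    rw [not_nonempty_iff] at h
    refine hμ₀ ((FiniteMeasure.mass_zero_iff μ₀).1 ?_)
    rw [FiniteMeasure.mass, univ_eq_empty_iff.2 h]
    simp
  obtain ⟨q, hq, hGq⟩ := hGgrowth
  obtain ⟨p, hp, hnp, hgrowth⟩ := DualPolar.exists_hasPowerGrowth hG hGconv hq hGq
  obtain ⟨a, ha, hhat⟩ := hG.hatB_eq_tildeB_rescale hGconv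
  refine ⟨DualPolar.existsUnique_isSolution_and_tendsto hφ hφconv hG hGconv hp hnp hgrowth
    hμ hμ₀ hμH hμ₀H hlim, ?_⟩
  rw [hhat]
  exact DualPolar.existsUnique_isSolution_and_tendsto hφ hφconv (hG.rescale ha)
    (fun u => DualPolar.convexOn_rescale ha (hGconv u)) hp hnp (hgrowth.rescale ha)
    hμ hμ₀ hμH hμ₀H hlim
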